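/- Let $b\in\mathbb C$ with $k:=2\operatorname{Re}(b^2)\in\mathbb Z$ and $\operatorname{Im}(b^2)>0$. Let $\mathcal H$ (the two-factor space, i.e. smooth sections of $L^k\boxtimes L^k$ over $T^2\times T^2$) be the space of all $s\in C^\infty(\mathbb R^4)$, in variables $(u_1',v_1',u_2',v_2')$, such that for $i=1,2$ $$s|_{u_i'\to u_i'+1}=e^{\pi i k v_i'}s,\qquad s|_{v_i'\to v_i'+1}=e^{-\pi i k u_i'}s .$$ Put $t=4\pi b^2$, $\nabla_{u_i'}=\partial_{u_i'}+i\pi k v_i'$, $\nabla_{v_i'}=\partial_{v_i'}-i\pi k u_i'$, $$P_{u_i'}=-\tfrac{i}{t}\nabla_{v_i'}+u_i',\quad P_{u_i''}=-\tfrac1t\nabla_{v_i'},\quad P_{v_i'}=\tfrac{i}{\bar t}\nabla_{u_i'}+v_i',\quad P_{v_i''}=-\tfrac1{\bar t}\nabla_{u_i'}$$ (the pre-quantum operators of $u_i=u_i'+iu_i''$, $v_i=v_i'+iv_i''$ on polarised sections restricted to $u''=v''=0$), and $$q_i=ib(P_{u_i'}+iP_{u_i''}),\quad p_i=ib(P_{v_i'}+iP_{v_i''}),\quad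 \tilde q_i=-i\bar b(P_{u_i'}-iP_{u_i''}),\quad \tilde p_i=-i\bar b(P_{v_i'}-iP_{v_i''}).$$ Let $c_b=\frac i2(b+b^{-1})$, $(x;q)_\infty=\prod_{j\ge0}(1-xq^j)$, and let $$\Psi(z)=\bigl(e^{2\pi b^{-1}(z-c_b)};e^{-2\pi i b^{-2}}\bigr)_\infty,\qquad \bar\Psi(z)=\overline{\Psi(\bar z)}=\bigl(e^{2\pi\bar b^{-1}(z-\overline{c_b})};e^{2\pi i\bar b^{-2}}\bigr)_\infty ;$$ $\Psi$ is an entire solution of $\Psi(z+\tfrac{i}{2b})=\Psi(z-\tfrac{i}{2b})(1+e^{2\pi b^{-1}z})$. Consider the unbounded operator $$\widetilde T=\frac{\Psi(q_1-p_1+p_2)}{\bar\Psi(\tilde q_1-\tilde p_1+\tilde p_2)}\,e^{2\pi i(p_1q_2+\tilde p_1\tilde q_2)},$$ acting on analytic sections, i.e. on functions on $\mathbb R^4$ that extend to entire functions on $\mathbb C^4$, as the composition $\Psi(\cdot)\,\bar\Psi(\cdot)^{-1}e^{2\pi i(\cdot)}$. Here $e^D=\sum_n D^n/n!$. If $f(z)=h(e^{2\pi\beta(z-c)})$,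 where $h(x)=\sum_n a_nx^n$ near $0$, then $f(D)S=\sum_n a_nX^nS$ with $X=e^{2\pi\beta(D-c)}$, and $S$ is in the domain if this series converges locally uniformly on $\mathbb C^4$; this is used for $\Psi$, for $\bar\Psi$, and for $1/\bar\Psi$. The operator $\bar\Psi(\tilde D)^{-1}$, $\tilde D=\tilde q_1-\tilde p_1+\tilde p_2$, sends $S$ to $(1/\bar\Psi)(\tilde D)S$, and its domain consists of those $S$ for which moreover $\bar\Psi(\tilde D)$ is defined on this section and maps it back to $S$. Then $\widetilde T$ is a well-defined (single-valued) operator, its domain intersected with $\mathcal H$ is dense in $\mathcal H$ for the supremum norm, and $\widetilde T$ preserves $\mathcal H$: if $s\in\mathcal H$ lies in the domain of $\widetilde T$, then $\widetilde Ts\in\mathcal H$. -/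

import Mathlib

noncomputable section

namespace ComplexCS

open Complex ComplexConjugate

/-- Labels of the coordinates on two copies of the plane: `(i, 0)` is the coordinate `u'` and
`(i, 1)` is the coordinate `v'` of the `i`-th copy (the copies are numbered `0, 1`). -/
abbrev Coord : Type := Fin 2 × Fin 2

/-- The quasi-periodic smooth sections at level `k`, in two pairs of variables `(u'_i, v'_i)`:
`s(u'_i + 1, v'_i) = e^{π i k v'_i} s` and `s(u'_i, v'_i + 1) = e^{-π i k u'_i} s`.
These are the smooth sections of `L^k ⊠ L^k` over `T² × T²`. -/
def quasiPeriodic (k : ℤ) : Set ((Coord → ℝ) → ℂ) :=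
  {s | ContDiff ℝ (⊤ : ℕ∞) s ∧
    ∀ (i : Fin 2) (x : Coord → ℝ),
      s (x + Pi.single (i, 0) 1) = exp (Real.pi * I * k * x (i, 1)) * s x ∧
      s (x + Pi.single (i, 1) 1) = exp (-(Real.pi * I * k * x (i, 0))) * s x}

/-- Functions of the complexified coordinates. -/
abbrev Fn : Type := (Coord → ℂ) → ℂ

/-- Operators on functions, with pointwise addition and scalar multiplication. -/
abbrev Op : Type := Fn → Fn

/-- Multiplication by the coordinate function `j`. -/
def mulCoord (j : Coord) : Op := fun S x => x j * S x

/-- The partial derivative in the coordinate `j`. -/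
def partialD (j : Coord) : Op := fun S x => fderiv ℂ S x (Pi.single j 1)

/-- The covariant derivative `∇_{∂/∂u'_i} = ∂/∂u'_i + i k π v'_i`. -/
def nablaU (k : ℤ) (i : Fin 2) : Op :=
  partialD (i, 0) + (I * k * Real.pi) • mulCoord (i, 1)

/-- The covariant derivative `∇_{∂/∂v'_i} = ∂/∂v'_i - i k π u'_i`. -/
def nablaV (k : ℤ) (i : Fin 2) : Op :=
  partialD (i, 1) - (I * k * Real.pi) • mulCoord (i, 0)

/-- The parameter `t = 4 π b²` of the symplectic form. -/
def tParam (b : ℂ) : ℂ := 4 * Real.pi * b ^ 2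

/-- The pre-quantum operator of the coordinate `u'` of the `i`-th copy, acting on polarised sections
(covariantly constant along `∂/∂u` and `∂/∂v̄`) restricted to the transversal `u'' = v'' = 0`. -/
def preQuantumRealU (b : ℂ) (k : ℤ) (i : Fin 2) : Op :=
  (-(I / tParam b)) • nablaV k i + mulCoord (i, 0)

/-- The pre-quantum operator of `u''` of the `i`-th copy, in the same representation. -/
def preQuantumImagU (b : ℂ) (k : ℤ) (i : Fin 2) : Op :=
  (-(1 / tParam b)) • nablaV k i

/-- The pre-quantum operator of `v'` of the `i`-th copy, in the same representation. -/
def preQuantumRealV (b : ℂ) (k : ℤ) (i : Fin 2) : Op :=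
  (I / conj (tParam b)) • nablaU k i + mulCoord (i, 1)

/-- The pre-quantum operator of `v''` of the `i`-th copy, in the same representation. -/
def preQuantumImagV (b : ℂ) (k : ℤ) (i : Fin 2) : Op :=
  (-(1 / conj (tParam b))) • nablaU k i

/-- `q_i = i b P_{u_i}` with `u = u' + i u''`. -/
def opQ (b : ℂ) (k : ℤ) (i : Fin 2) : Op :=
  (I * b) • (preQuantumRealU b k i + I • preQuantumImagU b k i)

/-- `p_i = i b P_{v_i}` with `v = v' + i v''`. -/
def opP (b : ℂ) (k : ℤ) (i : Fin 2) : Op :=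
  (I * b) • (preQuantumRealV b k i + I • preQuantumImagV b k i)

/-- `q̃_i = -i b̄ P_{ū_i}` with `ū = u' - i u''`. -/
def opQt (b : ℂ) (k : ℤ) (i : Fin 2) : Op :=
  (-(I * conj b)) • (preQuantumRealU b k i - I • preQuantumImagU b k i)

/-- `p̃_i = -i b̄ P_{v̄_i}` with `v̄ = v' - i v''`. -/
def opPt (b : ℂ) (k : ℤ) (i : Fin 2) : Op :=
  (-(I * conj b)) • (preQuantumRealV b k i - I • preQuantumImagV b k i)

/-- The exponential of an operator, `e^D S = ∑ Dⁿ S / n!`. -/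
def opExp (D : Op) : Op := fun S x => ∑' n : ℕ, (n.factorial : ℂ)⁻¹ * (D^[n] S) x

/-- `h(X) S = R` for the power series `h(x) = ∑ aₙ xⁿ` at `0` of `h`: the series `∑ aₙ Xⁿ S`
converges to `R`, locally uniformly on the complexified coordinate space. -/
def PowerSeriesApply (h : ℂ → ℂ) (X : Op) (S R : Fn) : Prop :=
  HasSumLocallyUniformly
    (fun (n : ℕ) (x : Coord → ℂ) => iteratedDeriv n h 0 / (n.factorial : ℂ) * (X^[n] S) x) R

/-- `(x; q)_∞ = ∏ (1 - x qⁱ)`. -/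
def qPoch (x q : ℂ) : ℂ := ∏' i : ℕ, (1 - x * q ^ i)

/-- `c_b = i (b + b⁻¹) / 2`. -/
def cConst (b : ℂ) : ℂ := I * (b + b⁻¹) / 2

/-- The nome `e^{-2πi b⁻²}`. -/
def nome (b : ℂ) : ℂ := exp (-(2 * Real.pi * I * (b ^ 2)⁻¹))

/-- `q₁ - p₁ + p₂`. -/
def opN (b : ℂ) (k : ℤ) : Op := opQ b k 0 - opP b k 0 + opP b k 1

/-- `q̃₁ - p̃₁ + p̃₂`. -/
def opNt (b : ℂ) (k : ℤ) : Op := opQt b k 0 - opPt b k 0 + opPt b k 1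

/-- `e^{2π b⁻¹ (q₁ - p₁ + p₂ - c_b)}`. -/
def opX (b : ℂ) (k : ℤ) : Op :=
  opExp ((2 * Real.pi * b⁻¹) • (opN b k - cConst b • (id : Op)))

/-- `e^{2π b̄⁻¹ (q̃₁ - p̃₁ + p̃₂ - c̄_b)}`. -/
def opXt (b : ℂ) (k : ℤ) : Op :=
  opExp ((2 * Real.pi * (conj b)⁻¹) • (opNt b k - conj (cConst b) • (id : Op)))

/-- `Ψ(q₁ - p₁ + p₂) S = R`, where `Ψ(z) = (e^{2π b⁻¹ (z - c_b)}; e^{-2πi b⁻²})_∞`. -/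
def PsiApply (b : ℂ) (k : ℤ) (S R : Fn) : Prop :=
  PowerSeriesApply (fun x => qPoch x (nome b)) (opX b k) S R

/-- `Ψ̄(q̃₁ - p̃₁ + p̃₂) S = R`, where `Ψ̄(z)` is the complex conjugate of `Ψ(z̄)`, that is,
`Ψ̄(z) = (e^{2π b̄⁻¹ (z - c̄_b)}; e^{2πi b̄⁻²})_∞`. -/
def PsiBarApply (b : ℂ) (k : ℤ) (S R : Fn) : Prop :=
  PowerSeriesApply (fun x => qPoch x (conj (nome b))) (opXt b k) S R

/-- `Ψ̄(q̃₁ - p̃₁ + p̃₂)⁻¹ S = R`: the section `R` is given by the power series of `1 / Ψ̄`, and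
it is a preimage of `S` under `Ψ̄(q̃₁ - p̃₁ + p̃₂)`. -/
def PsiBarInvApply (b : ℂ) (k : ℤ) (S R : Fn) : Prop :=
  PowerSeriesApply (fun x => (qPoch x (conj (nome b)))⁻¹) (opXt b k) S R ∧ PsiBarApply b k R S

/-- `e^{2πi (p₁ q₂ + p̃₁ q̃₂)}`. -/
def opG (b : ℂ) (k : ℤ) : Op :=
  opExp ((2 * Real.pi * I) • (opP b k 0 ∘ opQ b k 1 + opPt b k 0 ∘ opQt b k 1))

/-- The graph of the (unbounded) operator
`T̃ = Ψ(q₁ - p₁ + p₂) Ψ̄(q̃₁ - p̃₁ + p̃₂)⁻¹ e^{2πi (p₁ q₂ + p̃₁ q̃₂)}`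
on analytic sections: `s` is the restriction of an entire function `S` to the real points, and
`r` is the restriction of `T̃ S`. -/
def TGraph (b : ℂ) (k : ℤ) (s r : (Coord → ℝ) → ℂ) : Prop :=
  ∃ S Q R : Fn, AnalyticOnNhd ℂ S Set.univ ∧
    (∀ x : Coord → ℝ, S (fun j => (x j : ℂ)) = s x) ∧
    PsiBarInvApply b k (opG b k S) Q ∧
    PsiApply b k Q R ∧
    ∀ x : Coord → ℝ, R (fun j => (x j : ℂ)) = r x

end ComplexCS

end

/-! On entire functions every exponential in the operator is geometric. `opX` and `opXt` are
translations by vectors with entries 0 or ±b⁻², respectively ±b̄⁻², followed by multiplication by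
the exponential of an affine function (`opX_eq`, `opXt_eq`). In `opG` the multiplication terms
cancel because b² + b̄² = k, which leaves composition with an integral shear (`opG_eq`). All three
preserve quasi-periodicity, and so do locally uniformly convergent power series in them; this gives
the invariance of the section space. Single-valuedness holds because an entire function is
determined by its values at real points and a convergent series by its terms.

Density is the hard part. Let q be the nome. The Taylor coefficients of Ψ decay like |q|^(m(m-1)/2),
while those of 1/Ψ̄ are only geometrically bounded. So it suffices that X^m X̃^n S, weighted by
|q|^(m(m-1)/2), decays faster than every geometric sequence (`Admissible`,
`Admissible.exists_apply`). The shifts move imaginary parts, so this follows from a Gaussian growth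
bound in the imaginary directions (`admissible_of_growth`). Twisted convolution of a section with a
Gaussian of parameter A gives an entire quasi-periodic function, and the growth bound is obtained
for A in the fixed window [2/5, 1/2] (`exists_exponent_le`, `exists_norm_smoothed_le`).

Within this window the Gaussian cannot be concentrated at a point. Instead, its averages are
holomorphic in A for Re A > 0. Modulo the closure of the admissible sections they vanish on the
window, hence for all A > 0, and A → ∞ recovers the original section
(`mem_of_gaussian_integral_mem`). Undoing the shear, which does not change the supremum norm,
carries density over to the domain of the full operator. -/

noncomputable section

open Filter Topology Metric Set MeasureTheory
open scoped ContDiff ENNReal NNReal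

namespace ComplexCS

/-! ### Locally uniform limits of holomorphic functions of several variables -/

section LocallyUniformLimits

variable {ι E G : Type} [NormedAddCommGroup E] [NormedSpace ℂ E]
  [NormedAddCommGroup G] [NormedSpace ℂ G] {p : Filter ι}

/-- Cauchy's estimate on `ball y 1`, which lies in `closedBall x 2`, bounds the derivative of a
difference `F m - F n` at `y` by the size of that difference. -/
theorem uniformCauchySeqOn_fderiv {F : ι → E → G} {x : E}
    (hF : ∀ i, Differentiable ℂ (F i)) (h : UniformCauchySeqOn F p (closedBall x 2)) :
    UniformCauchySeqOn (fun i => fderiv ℂ (F i)) p (ball x 1) := by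
  intro u hu
  obtain ⟨ε, hε, hεu⟩ := Metric.mem_uniformity_dist.1 hu
  filter_upwards [h _ (Metric.dist_mem_uniformity (show 0 < ε / 4 by positivity))] with m hm y hy
  refine hεu ?_
  have hsub : ∀ z ∈ ball y 1, z ∈ closedBall x 2 := by
    intro z hz
    have := dist_triangle z y x
    simp only [mem_ball, mem_closedBall] at *
    linarith
  have hb : ∀ z ∈ ball y 1, ‖F m.1 z - F m.2 z‖ ≤ ε / 4 := fun z hz => by
    rw [← dist_eq_norm]; exact (hm z (hsub z hz)).le
  rw [dist_eq_norm, ← fderiv_sub (hF _ _) (hF _ _)]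
  have := Complex.norm_fderiv_le_div_of_mapsTo_ball (f := F m.1 - F m.2) (c := y) (R₁ := 1)
    (R₂ := ε / 2) ((hF _).sub (hF _)).differentiableOn (by
      intro z hz
      rw [mem_closedBall, dist_eq_norm]
      refine (norm_sub_le _ _).trans ?_
      have h1 := hb z hz
      have h2 := hb y (mem_ball_self one_pos)
      simp only [Pi.sub_apply]
      linarith) one_pos
  exact lt_of_le_of_lt this (by linarith)

variable [ProperSpace E]

theorem exists_hasFDerivAt_of_tendstoLocallyUniformly [CompleteSpace G] [NeBot p]
    {F : ι → E → G} {f : E → G}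
    (hF : ∀ i, Differentiable ℂ (F i)) (h : TendstoLocallyUniformly F f p) :
    ∃ f' : E → E →L[ℂ] G, (∀ x, HasFDerivAt f (f' x) x) ∧
      TendstoLocallyUniformly (fun i => fderiv ℂ (F i)) f' p := by
  have hc : ∀ x, UniformCauchySeqOn (fun i => fderiv ℂ (F i)) p (ball x 1) := fun x =>
    uniformCauchySeqOn_fderiv hF
      ((tendstoLocallyUniformly_iff_forall_isCompact.1 h _
        (isCompact_closedBall x 2)).uniformCauchySeqOn)
  have hl : ∀ x, ∃ L, Tendsto (fun i => fderiv ℂ (F i) x) p (𝓝 L) := fun x =>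
    cauchy_map_iff_exists_tendsto.1 ((hc x).cauchy_map (mem_ball_self one_pos))
  choose f' hf' using hl
  have hu : TendstoLocallyUniformly (fun i => fderiv ℂ (F i)) f' p := by
    intro u hu x
    exact ⟨ball x 1, ball_mem_nhds x one_pos,
      (hc x).tendstoUniformlyOn_of_tendsto (fun y _ => hf' y) u hu⟩
  refine ⟨f', fun x => ?_, hu⟩
  exact hasFDerivAt_of_tendstoLocallyUniformlyOn isOpen_univ
    (tendstoLocallyUniformlyOn_univ.2 hu)
    (fun i y _ => (hF i y).hasFDerivAt)
    (fun y _ => (tendstoLocallyUniformlyOn_univ.2 h).tendsto_at (mem_univ y)) (mem_univ x)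

/-- Locally uniform limits of smooth functions of several complex variables are smooth. -/
theorem contDiff_of_tendstoLocallyUniformly [NeBot p] (n : ℕ) :
    ∀ {G : Type} [NormedAddCommGroup G] [NormedSpace ℂ G] [CompleteSpace G]
      {F : ι → E → G} {f : E → G},
      (∀ i, ContDiff ℂ ∞ (F i)) → TendstoLocallyUniformly F f p → ContDiff ℂ n f := by
  induction n with
  | zero =>
    intro G _ _ _ F f hF h
    exact contDiff_zero.2 (h.continuous (Frequently.of_forall fun i => (hF i).continuous))
  | succ n ih =>
    intro G _ _ _ F f hF h
    obtain ⟨f', hf', hu⟩ := exists_hasFDerivAt_of_tendstoLocallyUniformly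
      (fun i => (hF i).differentiable (by simp)) h
    have hfd : fderiv ℂ f = f' := funext fun x => (hf' x).fderiv
    rw [Nat.cast_add, Nat.cast_one, contDiff_succ_iff_fderiv]
    refine ⟨fun x => (hf' x).differentiableAt, by simp, ?_⟩
    rw [hfd]
    -- The induction hypothesis is used for the derivatives, with values in `E →L[ℂ] G`; this is why
    -- `G` is quantified inside the induction.
    exact ih (fun i => (contDiff_infty_iff_fderiv.1 (hF i)).2) hu

end LocallyUniformLimits

/-- Entire functions of several variables. -/
abbrev Entire (S : Fn) : Prop := ContDiff ℂ ∞ S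

theorem Entire.of_hasSumLocallyUniformly {f : ℕ → Fn} {R : Fn} (hf : ∀ n, Entire (f n))
    (h : HasSumLocallyUniformly f R) : Entire R :=
  contDiff_infty.2 fun n => contDiff_of_tendstoLocallyUniformly n
    (fun _ : Finset ℕ => ContDiff.sum fun i _ => hf i) h

theorem hasSumLocallyUniformly_of_bound {f : ℕ → Fn}
    (h : ∀ r : ℝ, ∃ u : ℕ → ℝ, Summable u ∧ ∀ n x, ‖x‖ ≤ r → ‖f n x‖ ≤ u n) :
    HasSumLocallyUniformly f (fun x => ∑' n, f n x) := by
  refine hasSumLocallyUniformly_of_of_forall_exists_nhds fun x => ?_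
  obtain ⟨u, hu, hb⟩ := h (‖x‖ + 1)
  refine ⟨ball x 1, ball_mem_nhds x one_pos, ?_⟩
  rw [hasSumUniformlyOn_iff_tendstoUniformlyOn]
  refine tendstoUniformlyOn_tsum hu fun n y hy => hb n y ?_
  have := norm_sub_norm_le y x
  rw [mem_ball, dist_eq_norm] at hy
  linarith

/-- An entire function that vanishes on the real points vanishes. -/
theorem Entire.eq_zero_of_real {S : Fn} (hS : Differentiable ℂ S)
    (h : ∀ x : Coord → ℝ, S (fun j => (x j : ℂ)) = 0) : S = 0 := by
  classical
  -- The coordinates are released from the real axis one at a time, each by the one-variable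
  -- identity theorem.
  have key : ∀ T : Finset Coord, ∀ z : Coord → ℂ, (∀ j ∉ T, (z j).im = 0) → S z = 0 := by
    intro T
    induction T using Finset.induction_on with
    | empty =>
      intro z hz
      rw [← h fun j => (z j).re]
      congr 1
      ext j
      exact Complex.ext rfl (by simpa using hz j (by simp))
    | insert j T hj ih =>
      intro z hz
      have hg : AnalyticOnNhd ℂ (fun w : ℂ => S (Function.update z j w)) univ :=
        Complex.analyticOnNhd_univ_iff_differentiable.2
          (hS.comp fun w => (hasFDerivAt_update z w).differentiableAt)
      have hreal : ∀ w : ℝ, S (Function.update z j (w : ℂ)) = 0 := fun w => ih _ fun i hi => by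
        by_cases hij : i = j
        · subst hij; simp
        · rw [Function.update_of_ne hij]
          exact hz i (by simp [hij, hi])
      have hfr : ∃ᶠ w : ℂ in 𝓝[≠] 0, S (Function.update z j w) = 0 := by
        have ht : Tendsto (fun w : ℝ => (w : ℂ)) (𝓝[≠] 0) (𝓝[≠] 0) := by
          refine tendsto_nhdsWithin_iff.2 ⟨?_, ?_⟩
          · exact (Complex.continuous_ofReal.tendsto' 0 0 (by simp)).mono_left nhdsWithin_le_nhds
          · filter_upwards [self_mem_nhdsWithin] with w hw
            simpa using hw
        exact ht.frequently (Frequently.of_forall hreal)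
      have := hg.eqOn_zero_of_preconnected_of_frequently_eq_zero isPreconnected_univ
        (mem_univ 0) hfr (mem_univ (z j))
      simpa using this
  ext z
  exact key Finset.univ z (by simp)

/-- If `U τ` solves `∂ U τ S / ∂τ = U τ (D S)` with `U 0 = 1`, then `e^D = U 1`. -/
theorem opExp_eq {D : Op} {P : Fn → Prop} (hP : ∀ S, P S → P (D S)) {U : ℂ → Op} {S : Fn}
    (hS : P S) {x : Coord → ℂ} (h0 : ∀ S, P S → U 0 S x = S x)
    (hU : ∀ S, P S → ∀ τ, HasDerivAt (fun τ => U τ S x) (U τ (D S) x) τ) :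
    opExp D S x = U 1 S x := by
  have hPn : ∀ n, P (D^[n] S) := fun n => by
    induction n with
    | zero => exact hS
    | succ n ih => rw [Function.iterate_succ_apply']; exact hP _ ih
  have hd : ∀ n, iteratedDeriv n (fun τ => U τ S x) = fun τ => U τ (D^[n] S) x := fun n => by
    induction n with
    | zero => simp
    | succ n ih =>
      rw [iteratedDeriv_succ, ih, Function.iterate_succ_apply']
      exact funext fun τ => (hU _ (hPn n) τ).deriv
  -- The exponential series is the Taylor series at 0, evaluated at 1, of the entire function `τ ↦ U
  -- τ S x`.
  have := Complex.taylorSeries_eq_of_entire (f := fun τ => U τ S x)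
    (fun τ => (hU S hS τ).differentiableAt) 0 1
  rw [← this, opExp]
  refine tsum_congr fun n => ?_
  rw [hd n]
  simp [h0 _ (hPn n)]

open Complex ComplexConjugate

/-! ### The exponentials as shift operators -/

theorem Entire.differentiable {S : Fn} (hS : Entire S) : Differentiable ℂ S :=
  ContDiff.differentiable hS (by simp)

theorem Entire.fderiv_apply {S : Fn} (hS : Entire S) {V : (Coord → ℂ) → (Coord → ℂ)}
    (hV : ContDiff ℂ ∞ V) : Entire fun x => fderiv ℂ S x (V x) :=
  (contDiff_infty_iff_fderiv.1 hS).2.clm_apply hV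

/-- The flow generated by ∂_w + ℓ is S ↦ exp (τℓ + τ²κ/2) S(x + τw). The term κ/2 is the
Baker–Campbell–Hausdorff correction: ℓ itself varies at rate κ along w. -/
theorem opExp_affine {D : Op} {ℓ : Fn} {w : Coord → ℂ} {κ : ℂ} (hℓ : Entire ℓ)
    (hℓw : ∀ x (τ : ℂ), ℓ (x + τ • w) = ℓ x + τ * κ)
    (hD : ∀ S, Entire S → ∀ x, D S x = fderiv ℂ S x w + ℓ x * S x) {S : Fn} (hS : Entire S) :
    opExp D S = fun x => exp (ℓ x + κ / 2) * S (x + w) := by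
  ext x
  have hP : ∀ S, Entire S → Entire (D S) := fun S hS => by
    have : D S = fun x => fderiv ℂ S x w + ℓ x * S x := funext (hD S hS)
    rw [this]
    exact (hS.fderiv_apply contDiff_const).add (hℓ.mul hS)
  rw [opExp_eq (P := Entire) (x := x) hP
    (U := fun τ S x => exp (τ * ℓ x + τ ^ 2 * (κ / 2)) * S (x + τ • w)) hS]
  · simp
  · intro S _
    simp
  · intro S hS τ
    rw [hD S hS, hℓw]
    have h1 : HasDerivAt (fun τ : ℂ => x + τ • w) w τ := by
      simpa using ((hasDerivAt_id τ).smul_const w).const_add x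
    have h2 := (hS.differentiable (x + τ • w)).hasFDerivAt.comp_hasDerivAt τ h1
    have h3 : HasDerivAt (fun τ : ℂ => τ * ℓ x + τ ^ 2 * (κ / 2)) (ℓ x + τ * κ) τ := by
      have := ((hasDerivAt_id τ).mul_const (ℓ x)).add
        (((hasDerivAt_id τ).pow 2).mul_const (κ / 2))
      refine this.congr_deriv ?_
      simp only [id]
      ring
    refine (h3.cexp.mul h2).congr_deriv ?_
    simp only [Function.comp]
    ring

/-- Since N² = 0, the vector field x ↦ N x is constant along its trajectories x + τ N x, so its
time-one flow is a shear. -/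
theorem opExp_nilpotent {D : Op} {N : (Coord → ℂ) →L[ℂ] (Coord → ℂ)} (hN : ∀ x, N (N x) = 0)
    (hD : ∀ S, Entire S → ∀ x, D S x = fderiv ℂ S x (N x)) {S : Fn} (hS : Entire S) :
    opExp D S = fun x => S (x + N x) := by
  ext x
  have hP : ∀ S, Entire S → Entire (D S) := fun S hS => by
    rw [show D S = fun x => fderiv ℂ S x (N x) from funext (hD S hS)]
    exact hS.fderiv_apply N.contDiff
  rw [opExp_eq (P := Entire) (x := x) hP (U := fun τ S x => S (x + τ • N x)) hS]
  · simp
  · intro S _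
    simp
  · intro S hS τ
    rw [hD S hS]
    have h1 : HasDerivAt (fun τ : ℂ => x + τ • N x) (N x) τ := by
      simpa using ((hasDerivAt_id τ).smul_const (N x)).const_add x
    have h2 := (hS.differentiable (x + τ • N x)).hasFDerivAt.comp_hasDerivAt τ h1
    refine h2.congr_deriv ?_
    simp [hN]

section Formulas

variable (b : ℂ) (k : ℤ)

theorem opP_apply (i : Fin 2) (S : Fn) (x : Coord → ℂ) :
    opP b k i S x = I * b * (x (i, 1) * S x) := by
  simp only [opP, preQuantumRealV, preQuantumImagV, Pi.add_apply, Pi.smul_apply, smul_eq_mul,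
    mulCoord]
  ring

theorem opQt_apply (i : Fin 2) (S : Fn) (x : Coord → ℂ) :
    opQt b k i S x = -(I * conj b) * (x (i, 0) * S x) := by
  simp only [opQt, preQuantumRealU, preQuantumImagU, Pi.add_apply, Pi.sub_apply, Pi.smul_apply,
    smul_eq_mul, mulCoord]
  ring

theorem opQ_apply {b : ℂ} (hb : b ≠ 0) (i : Fin 2) (S : Fn) (x : Coord → ℂ) :
    opQ b k i S x = I * b * (x (i, 0) * S x) + (2 * Real.pi * b)⁻¹ *
      (fderiv ℂ S x (Pi.single (i, 1) 1) - I * k * Real.pi * (x (i, 0) * S x)) := by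
  have hpi : (Real.pi : ℂ) ≠ 0 := ofReal_ne_zero.2 Real.pi_ne_zero
  simp only [opQ, preQuantumRealU, preQuantumImagU, Pi.add_apply, Pi.smul_apply,
    smul_eq_mul, mulCoord, nablaV, partialD, Pi.sub_apply, tParam]
  field_simp
  linear_combination (-4 * fderiv ℂ S x (Pi.single (i, 1) 1)
    + 4 * I * k * Real.pi * x (i, 0) * S x) * I_sq

theorem opPt_apply {b : ℂ} (hb : b ≠ 0) (i : Fin 2) (S : Fn) (x : Coord → ℂ) :
    opPt b k i S x = -(I * conj b) * (x (i, 1) * S x) + (2 * Real.pi * conj b)⁻¹ *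
      (fderiv ℂ S x (Pi.single (i, 0) 1) + I * k * Real.pi * (x (i, 1) * S x)) := by
  have hpi : (Real.pi : ℂ) ≠ 0 := ofReal_ne_zero.2 Real.pi_ne_zero
  have hb' : conj b ≠ 0 := by simpa using hb
  simp only [opPt, preQuantumRealV, preQuantumImagV, Pi.add_apply, Pi.smul_apply,
    smul_eq_mul, mulCoord, nablaU, partialD, Pi.sub_apply, tParam, map_mul, map_pow, conj_ofReal,
    map_ofNat]
  field_simp
  linear_combination (-4 * fderiv ℂ S x (Pi.single (i, 0) 1)
    - 4 * I * k * Real.pi * x (i, 1) * S x) * I_sq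

/-- The multiplier of the shift operator `opX`. -/
def multX (x : Coord → ℂ) : ℂ :=
  2 * Real.pi * I * (x (0, 0) - x (0, 1) + x (1, 1)) - I * k * Real.pi * (b ^ 2)⁻¹ * x (0, 0)
    - Real.pi * I * (1 + 2 * (b ^ 2)⁻¹)

/-- The multiplier of the shift operator `opXt`. -/
def multXt (x : Coord → ℂ) : ℂ :=
  -(2 * Real.pi * I * (x (0, 0) - x (0, 1) + x (1, 1)))
    - I * k * Real.pi * (conj b ^ 2)⁻¹ * (x (0, 1) - x (1, 1))
    + Real.pi * I * (1 + 2 * (conj b ^ 2)⁻¹)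

theorem entire_multX : Entire (multX b k) := by
  unfold Entire multX
  fun_prop

theorem entire_multXt : Entire (multXt b k) := by
  unfold Entire multXt
  fun_prop

/-- The shift of `opX`. -/
def shX : Coord → ℂ := Pi.single (0, 1) (b ^ 2)⁻¹

/-- The shift of `opXt`. -/
def shXt : Coord → ℂ := Pi.single (1, 0) (conj b ^ 2)⁻¹ - Pi.single (0, 0) (conj b ^ 2)⁻¹

/-- The explicit form of `opX`. -/
def shiftX : Op := fun S x => exp (multX b k x) * S (x + shX b)

/-- The explicit form of `opXt`. -/
def shiftXt : Op := fun S x => exp (multXt b k x) * S (x + shXt b)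

/-- The nilpotent matrix with exponential `opG`. -/
def nilG : (Coord → ℂ) →L[ℂ] (Coord → ℂ) :=
  ContinuousLinearMap.pi fun j =>
    if j = (0, 0) then ContinuousLinearMap.proj (1, 0)
    else if j = (1, 1) then -ContinuousLinearMap.proj (0, 1) else 0

theorem nilG_apply (x : Coord → ℂ) :
    nilG x = Pi.single (0, 0) (x (1, 0)) - Pi.single (1, 1) (x (0, 1)) := by
  ext ⟨i, j⟩
  fin_cases i <;> fin_cases j <;> simp [nilG]

variable {b}

theorem fderiv_single (S : Fn) (x : Coord → ℂ) (j : Coord) (c : ℂ) :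
    fderiv ℂ S x (Pi.single j c) = c * fderiv ℂ S x (Pi.single j 1) := by
  rw [← smul_eq_mul, ← map_smul, ← Pi.single_smul, smul_eq_mul, mul_one]

/-- The zero-order parts of p₁q₂ and p̃₁q̃₂ are (k/2 - b²) v₁u₂ and (k/2 - b̄²) v₁u₂, which cancel
by `hk`. After multiplication by 2πi the vector field u₂ ∂/∂u₁ - v₁ ∂/∂v₂ remains. -/
theorem opG_eq (hb : b ≠ 0) (hk : b ^ 2 + conj b ^ 2 = k) {S : Fn} (hS : Entire S) :
    opG b k S = fun x => S (x + nilG x) := by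
  have hpi : (Real.pi : ℂ) ≠ 0 := ofReal_ne_zero.2 Real.pi_ne_zero
  have hb' : conj b ≠ 0 := by simpa using hb
  refine opExp_nilpotent (fun x => ?_) (fun S hS x => ?_) hS
  · rw [nilG_apply, nilG_apply]; simp
  · rw [nilG_apply, map_sub, fderiv_single, fderiv_single S x (1, 1)]
    simp only [Pi.smul_apply, Pi.add_apply, Function.comp, opP_apply, opQ_apply _ hb,
      opPt_apply _ hb, smul_eq_mul]
    have h1 : opQt b k 1 S = fun x => (-(I * conj b)) * (x (1, 0) * S x) :=
      funext fun x => opQt_apply b k 1 S x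
    have h2 : fderiv ℂ (opQt b k 1 S) x (Pi.single (0, 0) 1)
        = -(I * conj b) * (x (1, 0) * fderiv ℂ S x (Pi.single (0, 0) 1)) := by
      rw [h1]
      have hp : HasFDerivAt (fun x : Coord → ℂ => x (1, 0))
        (ContinuousLinearMap.proj (R := ℂ) (φ := fun _ : Coord => ℂ) (1, 0)) x :=
        (ContinuousLinearMap.proj (R := ℂ) (φ := fun _ : Coord => ℂ) (1, 0)).hasFDerivAt
      have : HasFDerivAt (fun x => -(I * conj b) * (x (1, 0) * S x)) _ x :=
        (hp.mul (hS.differentiable x).hasFDerivAt).const_mul (-(I * conj b))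
      rw [this.fderiv]
      simp
    rw [h2, opQt_apply, ← hk]
    field_simp
    ring_nf
    simp only [I_sq]
    ring

theorem opX_eq (hb : b ≠ 0) {S : Fn} (hS : Entire S) : opX b k S = shiftX b k S := by
  have hpi : (Real.pi : ℂ) ≠ 0 := ofReal_ne_zero.2 Real.pi_ne_zero
  -- `multX` already includes the correction κ/2, so ℓ is `multX` minus κ/2.
  rw [opX, opExp_affine (w := shX b) (κ := -(2 * Real.pi * I * (b ^ 2)⁻¹))
    (ℓ := fun x => multX b k x + Real.pi * I * (b ^ 2)⁻¹) _ _ _ hS]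
  · ext x
    simp only [shiftX]
    ring_nf
  · exact (entire_multX b k).add contDiff_const
  · intro x τ
    simp [multX, shX]
    ring
  · intro S hS x
    simp only [opN, Pi.smul_apply, Pi.add_apply, Pi.sub_apply, opP_apply, opQ_apply _ hb,
      smul_eq_mul, id, shX, multX, cConst]
    rw [fderiv_single S x (0, 1) (b ^ 2)⁻¹]
    field_simp
    ring

theorem opXt_eq (hb : b ≠ 0) {S : Fn} (hS : Entire S) : opXt b k S = shiftXt b k S := by
  have hpi : (Real.pi : ℂ) ≠ 0 := ofReal_ne_zero.2 Real.pi_ne_zero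
  have hb' : conj b ≠ 0 := by simpa using hb
  rw [opXt, opExp_affine (w := shXt b) (κ := 2 * Real.pi * I * (conj b ^ 2)⁻¹)
    (ℓ := fun x => multXt b k x - Real.pi * I * (conj b ^ 2)⁻¹) _ _ _ hS]
  · ext x
    simp only [shiftXt]
    ring_nf
  · exact (entire_multXt b k).sub contDiff_const
  · intro x τ
    simp [multXt, shXt]
    ring
  · intro S hS x
    simp only [opNt, Pi.smul_apply, Pi.add_apply, Pi.sub_apply, opQt_apply, opPt_apply _ hb,
      smul_eq_mul, id, shXt, multXt, cConst, map_div₀, map_mul, map_add, map_inv₀, conj_I, map_ofNat]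
    rw [map_sub, fderiv_single S x (1, 0) (conj b ^ 2)⁻¹,
      fderiv_single S x (0, 0) (conj b ^ 2)⁻¹]
    field_simp
    ring

theorem Entire.shiftX {S : Fn} (hS : Entire S) : Entire (shiftX b k S) := 
  (entire_multX b k).cexp.mul (hS.comp (contDiff_id.add contDiff_const))

theorem Entire.shiftXt {S : Fn} (hS : Entire S) : Entire (shiftXt b k S) := 
  (entire_multXt b k).cexp.mul (hS.comp (contDiff_id.add contDiff_const))

theorem Entire.iterate_shiftX {S : Fn} (hS : Entire S) (n : ℕ) :
    Entire ((ComplexCS.shiftX b k)^[n] S) := by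
  induction n with
  | zero => exact hS
  | succ n ih => rw [Function.iterate_succ_apply']; exact ih.shiftX k

theorem Entire.iterate_shiftXt {S : Fn} (hS : Entire S) (n : ℕ) :
    Entire ((ComplexCS.shiftXt b k)^[n] S) := by
  induction n with
  | zero => exact hS
  | succ n ih => rw [Function.iterate_succ_apply']; exact ih.shiftXt k

theorem iterate_opX_eq (hb : b ≠ 0) {S : Fn} (hS : Entire S) (n : ℕ) :
    (opX b k)^[n] S = (shiftX b k)^[n] S := by
  induction n with
  | zero => rfl
  | succ n ih =>
    rw [Function.iterate_succ_apply', Function.iterate_succ_apply', ih,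
      opX_eq k hb (hS.iterate_shiftX k n)]

theorem iterate_opXt_eq (hb : b ≠ 0) {S : Fn} (hS : Entire S) (n : ℕ) :
    (opXt b k)^[n] S = (shiftXt b k)^[n] S := by
  induction n with
  | zero => rfl
  | succ n ih =>
    rw [Function.iterate_succ_apply', Function.iterate_succ_apply', ih,
      opXt_eq k hb (hS.iterate_shiftXt k n)]

theorem Entire.comp_nilG {S : Fn} (hS : Entire S) : Entire fun x => S (x + nilG x) :=
  hS.comp (contDiff_id.add nilG.contDiff)

end Formulas

section

/-! ### Quasi-periodicity and single-valuedness -/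

/-- The complexified point of a real point. -/
def toC (x : Coord → ℝ) : Coord → ℂ := fun j => (x j : ℂ)

/-- Quasi-periodicity of a function of the complexified coordinates. -/
def QuasiPer (k : ℤ) (S : Fn) : Prop :=
  ∀ (i : Fin 2) (x : Coord → ℂ),
    S (x + Pi.single (i, 0) 1) = exp (Real.pi * I * k * x (i, 1)) * S x ∧
    S (x + Pi.single (i, 1) 1) = exp (-(Real.pi * I * k * x (i, 0))) * S x

theorem toC_add_single (x : Coord → ℝ) (j : Coord) :
    toC (x + Pi.single j 1) = toC x + Pi.single j 1 := by
  ext i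
  by_cases h : i = j
  · subst h; simp [toC]
  · simp [toC, h]

theorem quasiPer_of_real {k : ℤ} {S : Fn} (hS : Entire S) {s : (Coord → ℝ) → ℂ}
    (hs : s ∈ quasiPeriodic k) (h : ∀ x, S (toC x) = s x) : QuasiPer k S := by
  have h0 : ∀ (j l : Coord) (c : ℂ), (∀ x : Coord → ℝ, s (x + Pi.single j 1) =
      exp (c * x l) * s x) → ∀ x, S (x + Pi.single j 1) = exp (c * x l) * S x := by
    intro j l c hc x
    have hd : Differentiable ℂ fun x : Coord → ℂ =>
        S (x + Pi.single j 1) - exp (c * x l) * S x := by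
      have h1 := hS.differentiable
      have h2 : Differentiable ℂ fun x : Coord → ℂ => S (x + Pi.single j 1) :=
        h1.comp (differentiable_id.add_const _)
      exact h2.sub (((differentiable_apply (𝕜 := ℂ) l).const_mul c).cexp.mul h1)
    have := congrFun (Entire.eq_zero_of_real hd fun x => by
      have := hc x
      rw [← h, ← h, toC_add_single] at this
      exact sub_eq_zero.2 this) x
    exact sub_eq_zero.1 this
  intro i x
  refine ⟨h0 (i, 0) (i, 1) _ (fun x => (hs.2 i x).1) x, ?_⟩
  have := h0 (i, 1) (i, 0) (-(Real.pi * I * k)) (fun x => by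
    rw [(hs.2 i x).2, neg_mul]) x
  rw [this, neg_mul]

theorem contDiff_toC : ContDiff ℝ ∞ toC := by
  refine contDiff_pi.2 fun j => ?_
  exact ofRealCLM.contDiff.comp (contDiff_apply ℝ ℝ j)

theorem mem_quasiPeriodic {k : ℤ} {S : Fn} (hS : Entire S) (hq : QuasiPer k S) :
    (fun x => S (toC x)) ∈ quasiPeriodic k := by
  refine ⟨(hS.restrict_scalars ℝ).comp contDiff_toC, fun i x => ?_⟩
  simp only [toC_add_single]
  exact hq i (toC x)

theorem QuasiPer.of_hasSumLocallyUniformly {k : ℤ} {f : ℕ → Fn} {R : Fn}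
    (hf : ∀ n, QuasiPer k (f n)) (h : HasSumLocallyUniformly f R) : QuasiPer k R := by
  intro i x
  constructor
  · refine (h.hasSum (x := _)).unique ?_
    simp only [fun n => (hf n i x).1]
    exact h.hasSum.mul_left _
  · refine (h.hasSum (x := _)).unique ?_
    simp only [fun n => (hf n i x).2]
    exact h.hasSum.mul_left _

theorem QuasiPer.const_mul {k : ℤ} {S : Fn} (hS : QuasiPer k S) (c : ℂ) :
    QuasiPer k fun x => c * S x := by
  intro i x
  simp only [(hS i x).1, (hS i x).2]
  constructor <;> ring

theorem exp_two_pi_add (z : ℂ) : exp (z + 2 * Real.pi * I) = exp z := by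
  rw [exp_add, exp_two_pi_mul_I, mul_one]

variable {b : ℂ} {k : ℤ}

/-- Translating v₁ by b⁻² changes the factor for u₁ ↦ u₁ + 1 by exp (πik b⁻²), which the k-term of
`multX` undoes. The other linear coefficients of `multX` are ±2πi, invisible under unit steps. -/
theorem QuasiPer.shiftX {S : Fn} (hS : QuasiPer k S) : QuasiPer k (shiftX b k S) := by
  intro i x
  simp only [ComplexCS.shiftX, add_right_comm x (Pi.single _ 1), (hS i (x + shX b)).1,
    (hS i (x + shX b)).2]
  rw [← mul_assoc, ← mul_assoc, ← exp_add, ← mul_assoc, ← mul_assoc, ← exp_add, ← exp_add,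
    ← exp_add]
  fin_cases i
  · constructor
    · rw [← exp_two_pi_add (_ + multX b k x)]
      simp [multX, shX]
      left; congr 1; ring
    · rw [← exp_two_pi_add]
      simp [multX, shX]
      left; congr 1; ring
  · constructor
    · simp [multX, shX]
      left; congr 1; ring
    · rw [← exp_two_pi_add (_ + multX b k x)]
      simp [multX, shX]
      left; congr 1; ring

theorem QuasiPer.shiftXt {S : Fn} (hS : QuasiPer k S) : QuasiPer k (shiftXt b k S) := by
  intro i x
  simp only [ComplexCS.shiftXt, add_right_comm x (Pi.single _ 1), (hS i (x + shXt b)).1,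
    (hS i (x + shXt b)).2]
  rw [← mul_assoc, ← mul_assoc, ← exp_add, ← mul_assoc, ← mul_assoc, ← exp_add, ← exp_add,
    ← exp_add]
  fin_cases i
  · constructor
    · rw [← exp_two_pi_add]
      simp [multXt, shXt]
      left; congr 1; ring
    · rw [← exp_two_pi_add (_ + multXt b k x)]
      simp [multXt, shXt]
      left; congr 1; ring
  · constructor
    · simp [multXt, shXt]
      left; congr 1; ring
    · rw [← exp_two_pi_add]
      simp [multXt, shXt]
      left; congr 1; ring

theorem QuasiPer.iterate_shiftX {S : Fn} (hS : QuasiPer k S) (n : ℕ) :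
    QuasiPer k ((ComplexCS.shiftX b k)^[n] S) := by
  induction n with
  | zero => exact hS
  | succ n ih => rw [Function.iterate_succ_apply']; exact ih.shiftX

theorem QuasiPer.iterate_shiftXt {S : Fn} (hS : QuasiPer k S) (n : ℕ) :
    QuasiPer k ((ComplexCS.shiftXt b k)^[n] S) := by
  induction n with
  | zero => exact hS
  | succ n ih => rw [Function.iterate_succ_apply']; exact ih.shiftXt

/-! ### Quasi-periodicity under the integral shear -/

section Shear

variable {R : Type} [CommRing R] {φ : R →+* ℂ}

/-- Quasi-periodicity with coordinates in a ring with a given embedding into `ℂ`. -/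
def QuasiPerVia (φ : R →+* ℂ) (k : ℤ) (S : (Coord → R) → ℂ) : Prop :=
  ∀ (i : Fin 2) (x : Coord → R),
    S (x + Pi.single (i, 0) 1) = exp (Real.pi * I * k * φ (x (i, 1))) * S x ∧
    S (x + Pi.single (i, 1) 1) = exp (-(Real.pi * I * k * φ (x (i, 0)))) * S x

/-- The nilpotent map `nilG` with coordinates in a ring. -/
def nil (x : Coord → R) : Coord → R :=
  Pi.single (0, 0) (x (1, 0)) - Pi.single (1, 1) (x (0, 1))

theorem nil_add (x y : Coord → R) : nil (x + y) = nil x + nil y := by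
  simp only [nil, Pi.add_apply, Pi.single_add]
  abel

theorem nil_nil (x : Coord → R) : nil (nil x) = 0 := by
  simp [nil]

theorem QuasiPerVia.sub_single {S : (Coord → R) → ℂ} (hS : QuasiPerVia φ k S) 
    (i : Fin 2) (x : Coord → R) :
    S (x - Pi.single (i, 1) 1) = exp (Real.pi * I * k * φ (x (i, 0))) * S x := by
  have := (hS i (x - Pi.single (i, 1) 1)).2
  rw [sub_add_cancel] at this
  rw [this, ← mul_assoc, ← exp_add]
  simp

theorem QuasiPerVia.sub_single' {S : (Coord → R) → ℂ} (hS : QuasiPerVia φ k S) 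
    (i : Fin 2) (x : Coord → R) :
    S (x - Pi.single (i, 0) 1) = exp (-(Real.pi * I * k * φ (x (i, 1)))) * S x := by
  have := (hS i (x - Pi.single (i, 0) 1)).1
  rw [sub_add_cancel] at this
  rw [this, ← mul_assoc, ← exp_add]
  simp

/-- The shear sends lattice steps to lattice steps and is symplectic, so the extra factors combine
to the original ones. A general coordinate ring serves both complex points and the real points of a
merely smooth section. -/
theorem QuasiPerVia.comp_add_nil {S : (Coord → R) → ℂ} (hS : QuasiPerVia φ k S) :
    QuasiPerVia φ k fun x => S (x + nil x) := by
  intro i x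
  have hn : x + nil x = x + Pi.single (0, 0) (x (1, 0)) - Pi.single (1, 1) (x (0, 1)) := by
    rw [nil, add_sub_assoc]
  fin_cases i
  · constructor
    · have : x + Pi.single (0, 0) 1 + nil (x + Pi.single (0, 0) 1)
          = x + nil x + Pi.single (0, 0) 1 := by
        rw [nil_add, nil.eq_1 (Pi.single (0, 0) 1)]; simp; abel
      simp only [Fin.zero_eta, this, (hS _ _).1, hn]
      simp
    · have : x + Pi.single (0, 1) 1 + nil (x + Pi.single (0, 1) 1)
          = x + nil x + Pi.single (0, 1) 1 - Pi.single (1, 1) 1 := by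
        rw [nil_add, nil.eq_1 (Pi.single (0, 1) 1)]; simp; abel
      simp only [Fin.zero_eta, this, hS.sub_single, (hS _ _).2]
      rw [← mul_assoc, ← exp_add, hn]
      simp
      left; congr 1; ring
  · constructor
    · have : x + Pi.single (1, 0) 1 + nil (x + Pi.single (1, 0) 1)
          = x + nil x + Pi.single (1, 0) 1 + Pi.single (0, 0) 1 := by
        rw [nil_add, nil.eq_1 (Pi.single (1, 0) 1)]; simp; abel
      simp only [Fin.mk_one, this, (hS _ _).1]
      rw [← mul_assoc, ← exp_add, hn]
      simp
      left; congr 1; ring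
    · have : x + Pi.single (1, 1) 1 + nil (x + Pi.single (1, 1) 1)
          = x + nil x + Pi.single (1, 1) 1 := by
        rw [nil_add, nil.eq_1 (Pi.single (1, 1) 1)]; simp; abel
      simp only [Fin.mk_one, this, (hS _ _).2, hn]
      simp

theorem QuasiPerVia.comp_sub_nil {S : (Coord → R) → ℂ} (hS : QuasiPerVia φ k S) :
    QuasiPerVia φ k fun x => S (x - nil x) := by
  intro i x
  have hn : x - nil x = x - Pi.single (0, 0) (x (1, 0)) + Pi.single (1, 1) (x (0, 1)) := by
    rw [nil, sub_sub_eq_add_sub, add_sub_right_comm]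
  fin_cases i
  · constructor
    · have : x + Pi.single (0, 0) 1 - nil (x + Pi.single (0, 0) 1)
          = x - nil x + Pi.single (0, 0) 1 := by
        rw [nil_add, nil.eq_1 (Pi.single (0, 0) 1)]; simp; abel
      simp only [Fin.zero_eta, this, (hS _ _).1, hn]
      simp
    · have : x + Pi.single (0, 1) 1 - nil (x + Pi.single (0, 1) 1)
          = x - nil x + Pi.single (0, 1) 1 + Pi.single (1, 1) 1 := by
        rw [nil_add, nil.eq_1 (Pi.single (0, 1) 1)]; simp; abel
      simp only [Fin.zero_eta, this, (hS _ _).2]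
      rw [← mul_assoc, ← exp_add, hn]
      simp
      left; congr 1; ring
  · constructor
    · have : x + Pi.single (1, 0) 1 - nil (x + Pi.single (1, 0) 1)
          = x - nil x + Pi.single (1, 0) 1 - Pi.single (0, 0) 1 := by
        rw [nil_add, nil.eq_1 (Pi.single (1, 0) 1)]; simp; abel
      simp only [Fin.mk_one, this, hS.sub_single', (hS _ _).1]
      rw [← mul_assoc, ← exp_add, hn]
      simp
      left; congr 1; ring
    · have : x + Pi.single (1, 1) 1 - nil (x + Pi.single (1, 1) 1)
          = x - nil x + Pi.single (1, 1) 1 := by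
        rw [nil_add, nil.eq_1 (Pi.single (1, 1) 1)]; simp; abel
      simp only [Fin.mk_one, this, (hS _ _).2, hn]
      simp

end Shear

theorem QuasiPer.comp_add_nilG {S : Fn} (hS : QuasiPer k S) :
    QuasiPer k fun x => S (x + nilG x) := by
  simp only [nilG_apply]
  exact QuasiPerVia.comp_add_nil (φ := RingHom.id ℂ) hS

theorem QuasiPer.comp_sub_nilG {S : Fn} (hS : QuasiPer k S) :
    QuasiPer k fun x => S (x - nilG x) := by
  simp only [nilG_apply]
  exact QuasiPerVia.comp_sub_nil (φ := RingHom.id ℂ) hS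

theorem TGraph.unique {s r r' : (Coord → ℝ) → ℂ} (h : TGraph b k s r) (h' : TGraph b k s r') :
    r = r' := by
  obtain ⟨S, Q, R, hS, hs, hQ, hR, hr⟩ := h
  obtain ⟨S', Q', R', hS', hs', hQ', hR', hr'⟩ := h'
  have hSS : S = S' := by
    have hd : Differentiable ℂ (S - S') :=
      (hS.sub hS').contDiff (n := ∞) |>.differentiable (by simp)
    exact sub_eq_zero.1 (Entire.eq_zero_of_real hd fun x => by simp [hs, hs'])
  subst hSS
  have hQQ : Q = Q' := funext fun x => hQ.1.hasSum.unique hQ'.1.hasSum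
  subst hQQ
  ext x
  rw [← hr, ← hr']
  exact hR.hasSum.unique hR'.hasSum

theorem TGraph.mem_quasiPeriodic (hb : b ≠ 0) (hk : b ^ 2 + conj b ^ 2 = k)
    {s r : (Coord → ℝ) → ℂ} (hs : s ∈ quasiPeriodic k) (h : TGraph b k s r) :
    r ∈ quasiPeriodic k := by
  obtain ⟨S, Q, R, hS, hsS, hQ, hR, hr⟩ := h
  have eS : Entire S := hS.contDiff
  have qS : QuasiPer k S := quasiPer_of_real eS hs hsS
  have hQ := hQ.1
  rw [opG_eq k hb hk eS] at hQ
  simp only [PowerSeriesApply, iterate_opXt_eq k hb eS.comp_nilG] at hQ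
  have eQ : Entire Q := Entire.of_hasSumLocallyUniformly
    (fun n => contDiff_const.mul (eS.comp_nilG.iterate_shiftXt k n)) hQ
  have qQ : QuasiPer k Q := QuasiPer.of_hasSumLocallyUniformly
    (fun n => (qS.comp_add_nilG.iterate_shiftXt n).const_mul _) hQ
  simp only [PsiApply, PowerSeriesApply, iterate_opX_eq k hb eQ] at hR
  have eR : Entire R := Entire.of_hasSumLocallyUniformly
    (fun n => contDiff_const.mul (eQ.iterate_shiftX k n)) hR
  have qR : QuasiPer k R := QuasiPer.of_hasSumLocallyUniformly
    (fun n => (qQ.iterate_shiftX n).const_mul _) hR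
  have := ComplexCS.mem_quasiPeriodic eR qR
  rwa [show (fun x => R (toC x)) = r from funext hr] at this

end

section

/-! ### Power series of the `q`-Pochhammer symbol -/

/-- Taylor coefficients at `0`. -/
def taylorCoeff (h : ℂ → ℂ) (n : ℕ) : ℂ := iteratedDeriv n h 0 / (n.factorial : ℂ)

theorem eventually_hasSum_taylorCoeff {h : ℂ → ℂ} (hh : AnalyticAt ℂ h 0) :
    ∀ᶠ z in 𝓝 0, HasSum (fun n => taylorCoeff h n * z ^ n) (h z) := by
  filter_upwards [hasFPowerSeriesAt_iff.1 hh.hasFPowerSeriesAt] with z hz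
  simpa [taylorCoeff, mul_comm, FormalMultilinearSeries.coeff_ofScalars] using hz

theorem taylorCoeff_eq {h : ℂ → ℂ} {c : ℕ → ℂ}
    (hc : ∀ᶠ z in 𝓝 0, HasSum (fun n => c n * z ^ n) (h z)) : taylorCoeff h = c := by
  have h1 : HasFPowerSeriesAt h (FormalMultilinearSeries.ofScalars ℂ c) 0 := by
    rw [hasFPowerSeriesAt_iff]
    filter_upwards [hc] with z hz
    simpa [mul_comm, FormalMultilinearSeries.coeff_ofScalars] using hz
  have h2 := h1.analyticAt.hasFPowerSeriesAt
  have := h2.eq_formalMultilinearSeries h1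
  ext n
  have := congrArg (fun p => p.coeff n) this
  simpa [taylorCoeff, FormalMultilinearSeries.coeff_ofScalars] using this

theorem exists_norm_taylorCoeff_le {h : ℂ → ℂ} (hh : AnalyticAt ℂ h 0) :
    ∃ C > 0, ∃ r > 0, ∀ n, ‖taylorCoeff h n‖ ≤ C * r ^ n := by
  obtain ⟨δ, hδ, hs⟩ := Metric.eventually_nhds_iff.1 (eventually_hasSum_taylorCoeff hh)
  have h1 := (hs (y := (δ / 2 : ℝ)) (by
    rw [dist_zero_right, norm_real, Real.norm_of_nonneg] <;> linarith)).summable.norm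
  obtain ⟨C, hC⟩ := h1.tendsto_atTop_zero.bddAbove_range
  refine ⟨max C 1, by positivity, (δ / 2)⁻¹, by positivity, fun n => ?_⟩
  have h2 : ‖taylorCoeff h n‖ * (δ / 2) ^ n ≤ C := by
    have := hC (mem_range_self n)
    rwa [norm_mul, norm_pow, norm_real, Real.norm_of_nonneg (by positivity)] at this
  rw [inv_pow, ← div_eq_mul_inv, le_div_iff₀ (by positivity)]
  exact h2.trans (le_max_left _ _)

/-- Cauchy product of the two series near 0, where h · h⁻¹ = 1. It is what makes Ψ̄ undo the power
series of 1/Ψ̄. -/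
theorem sum_taylorCoeff_mul_inv {h : ℂ → ℂ} (hh : AnalyticAt ℂ h 0) (h0 : h 0 ≠ 0) (n : ℕ) :
    ∑ p ∈ Finset.HasAntidiagonal.antidiagonal n,
        taylorCoeff h p.1 * taylorCoeff (fun z => (h z)⁻¹) p.2
      = if n = 0 then 1 else 0 := by
  have h1 : taylorCoeff (fun _ => 1) = fun n => ∑ p ∈ Finset.HasAntidiagonal.antidiagonal n,
      taylorCoeff h p.1 * taylorCoeff (fun z => (h z)⁻¹) p.2 := by
    refine taylorCoeff_eq ?_
    filter_upwards [eventually_hasSum_taylorCoeff hh, eventually_hasSum_taylorCoeff (hh.inv h0),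
      hh.continuousAt.eventually_ne h0] with z hz1 hz2 hz3
    have hn1 := hz1.summable.norm
    have hn2 := hz2.summable.norm
    have he : ∀ n, (∑ p ∈ Finset.HasAntidiagonal.antidiagonal n, taylorCoeff h p.1 *
        taylorCoeff (fun z => (h z)⁻¹) p.2) * z ^ n = ∑ p ∈ Finset.HasAntidiagonal.antidiagonal n,
        (taylorCoeff h p.1 * z ^ p.1) * (taylorCoeff (fun z => (h z)⁻¹) p.2 * z ^ p.2) := by
      intro n
      rw [Finset.sum_mul]
      refine Finset.sum_congr rfl fun p hp => ?_
      rw [← Finset.HasAntidiagonal.mem_antidiagonal.1 hp, pow_add]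
      ring
    simp only [he]
    have hs := (summable_norm_sum_mul_antidiagonal_of_summable_norm hn1 hn2).of_norm
    have := tsum_mul_tsum_eq_tsum_sum_antidiagonal_of_summable_norm hn1 hn2
    have hz2' : (h⁻¹ z) = (h z)⁻¹ := rfl
    rw [hz1.tsum_eq, (show HasSum _ ((h z)⁻¹) from hz2).tsum_eq, mul_inv_cancel₀ hz3] at this
    rw [this]
    exact hs.hasSum
  have h2 : taylorCoeff (fun _ => 1) = fun n => if n = 0 then 1 else 0 := by
    refine taylorCoeff_eq (Eventually.of_forall fun z => ?_)
    convert! hasSum_single (f := fun n : ℕ => (if n = 0 then (1 : ℂ) else 0) * z ^ n) 0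
      (fun n hn => by simp [hn]) using 1
    simp
  exact congrFun (h1.symm.trans h2) n

/-- The coefficients of Euler's expansion of `(x; q)_∞`. -/
def eulerCoeff (q : ℂ) : ℕ → ℂ
  | 0 => 1
  | n + 1 => -(q ^ n / (1 - q ^ (n + 1))) * eulerCoeff q n

variable {q : ℂ}

theorem norm_eulerCoeff_succ_le (hq : ‖q‖ < 1) (n : ℕ) :
    ‖eulerCoeff q (n + 1)‖ ≤ ‖q‖ ^ n / (1 - ‖q‖) * ‖eulerCoeff q n‖ := by
  have h0 : 0 < 1 - ‖q‖ := by linarith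
  have h1 : 1 - ‖q‖ ≤ ‖1 - q ^ (n + 1)‖ := by
    have h2 := norm_sub_norm_le (1 : ℂ) (q ^ (n + 1))
    rw [norm_one, norm_pow] at h2
    have h3 : ‖q‖ ^ (n + 1) ≤ ‖q‖ := pow_le_of_le_one (norm_nonneg _) hq.le (by simp)
    linarith
  rw [eulerCoeff, norm_mul, norm_neg, norm_div, norm_pow]
  gcongr

/-- The exponent `n.choose 2` is the Gaussian decay built into `Admissible` as a weight; the
remaining factor is geometric. -/
theorem norm_eulerCoeff_le (hq : ‖q‖ < 1) (n : ℕ) :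
    ‖eulerCoeff q n‖ ≤ ((1 - ‖q‖)⁻¹) ^ n * ‖q‖ ^ (n.choose 2) := by
  induction n with
  | zero => simp [eulerCoeff]
  | succ n ih =>
    have h0 : 0 < 1 - ‖q‖ := by linarith
    have h4 : (n + 1).choose 2 = n + n.choose 2 := by
      rw [Nat.choose_succ_succ' n 1, Nat.choose_one_right]
    rw [h4]
    refine (norm_eulerCoeff_succ_le hq n).trans ?_
    calc ‖q‖ ^ n / (1 - ‖q‖) * ‖eulerCoeff q n‖
        ≤ ‖q‖ ^ n / (1 - ‖q‖) * (((1 - ‖q‖)⁻¹) ^ n * ‖q‖ ^ (n.choose 2)) := by gcongr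
      _ = _ := by rw [div_eq_mul_inv]; ring

theorem summable_eulerCoeff (hq : ‖q‖ < 1) (x : ℂ) :
    Summable fun n => eulerCoeff q n * x ^ n := by
  have h0 : Tendsto (fun n : ℕ => ‖q‖ ^ n / (1 - ‖q‖) * ‖x‖) atTop (𝓝 0) := by
    simpa using ((tendsto_pow_atTop_nhds_zero_of_lt_one (norm_nonneg q) hq).div_const
      (1 - ‖q‖)).mul_const ‖x‖
  refine summable_of_ratio_norm_eventually_le (r := 1 / 2) (by norm_num) ?_
  filter_upwards [h0.eventually_le_const (by norm_num : (0 : ℝ) < 1 / 2)] with n hn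
  rw [pow_succ, norm_mul, norm_mul, norm_mul]
  calc ‖eulerCoeff q (n + 1)‖ * (‖x ^ n‖ * ‖x‖)
      ≤ (‖q‖ ^ n / (1 - ‖q‖) * ‖eulerCoeff q n‖) * (‖x ^ n‖ * ‖x‖) := by
        gcongr; exact norm_eulerCoeff_succ_le hq n
    _ = (‖q‖ ^ n / (1 - ‖q‖) * ‖x‖) * (‖eulerCoeff q n‖ * ‖x ^ n‖) := by ring
    _ ≤ _ := by gcongr

/-- The sum e of Euler's series satisfies e(x) = (1 - x) e(qx). Iteration splits off the partial
products, and e(x q^N) → e(0) = 1. -/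
theorem hasSum_qPoch (hq : ‖q‖ < 1) (x : ℂ) :
    HasSum (fun n => eulerCoeff q n * x ^ n) (qPoch x q) := by
  set e : ℂ → ℂ := fun x => ∑' n, eulerCoeff q n * x ^ n with he
  have hfun : ∀ x, e x = (1 - x) * e (q * x) := by
    intro x
    have h1 := (summable_eulerCoeff hq (q * x)).hasSum
    have h2 : HasSum (fun n => eulerCoeff q (n + 1) * (q * x) ^ (n + 1)) (e (q * x) - 1) := by
      have := (hasSum_nat_add_iff' 1).2 h1
      simpa [eulerCoeff] using this
    have h3 := (h2.sub (h1.mul_left x))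
    have h4 : HasSum (fun n => eulerCoeff q (n + 1) * x ^ (n + 1)) (e x - 1) := by
      have := (hasSum_nat_add_iff' 1).2 (summable_eulerCoeff hq x).hasSum
      simpa [eulerCoeff] using this
    have h5 : ∀ n, eulerCoeff q (n + 1) * (q * x) ^ (n + 1) - x * (eulerCoeff q n * (q * x) ^ n)
        = eulerCoeff q (n + 1) * x ^ (n + 1) := by
      intro n
      have : 1 - q ^ (n + 1) ≠ 0 := by
        intro h0
        have := congrArg norm (sub_eq_zero.1 h0)
        rw [norm_one, norm_pow] at this
        exact absurd this (pow_lt_one₀ (norm_nonneg _) hq (by simp)).ne'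
      rw [eulerCoeff]
      field_simp
      ring
    simp only [h5] at h3
    have := h4.unique h3
    linear_combination this
  have hprod : ∀ N, (∏ i ∈ Finset.range N, (1 - x * q ^ i)) * e (x * q ^ N) = e x := by
    intro N
    induction N with
    | zero => simp
    | succ N ih =>
      rw [Finset.prod_range_succ, ← ih, hfun (x * q ^ N), pow_succ]
      ring_nf
  have hq0 : Tendsto (fun N : ℕ => x * q ^ N) atTop (𝓝 0) := by
    simpa using (tendsto_pow_atTop_nhds_zero_of_norm_lt_one hq).const_mul x
  have hcont : ContinuousAt e 0 := by
    have : HasFPowerSeriesAt e (FormalMultilinearSeries.ofScalars ℂ (eulerCoeff q)) 0 := by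
      rw [hasFPowerSeriesAt_iff]
      refine Eventually.of_forall fun z => ?_
      simpa [mul_comm, FormalMultilinearSeries.coeff_ofScalars] using
        (summable_eulerCoeff hq z).hasSum
    exact this.continuousAt
  have he0 : e 0 = 1 := by
    rw [he]
    refine (tsum_eq_single 0 fun n hn => by simp [hn]).trans (by simp [eulerCoeff])
  have hlim : Tendsto (fun N : ℕ => e (x * q ^ N)) atTop (𝓝 1) := by
    rw [← he0]; exact hcont.tendsto.comp hq0
  have hm : Multipliable fun i : ℕ => 1 - x * q ^ i := by
    have := multipliable_one_add_of_summable (f := fun i : ℕ => -(x * q ^ i)) (by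
      simpa using ((summable_geometric_of_lt_one (norm_nonneg _) hq).mul_left ‖x‖))
    simpa [sub_eq_add_neg] using this
  have := hm.hasProd.tendsto_prod_nat.mul hlim
  simp only [hprod] at this
  rw [qPoch, ← mul_one (∏' i : ℕ, (1 - x * q ^ i)), ← tendsto_nhds_unique tendsto_const_nhds this]
  exact (summable_eulerCoeff hq x).hasSum

theorem analyticAt_qPoch (hq : ‖q‖ < 1) : AnalyticAt ℂ (fun x => qPoch x q) 0 := by
  have : HasFPowerSeriesAt (fun x => qPoch x q)
      (FormalMultilinearSeries.ofScalars ℂ (eulerCoeff q)) 0 := by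
    rw [hasFPowerSeriesAt_iff]
    refine Eventually.of_forall fun z => ?_
    simpa [mul_comm, FormalMultilinearSeries.coeff_ofScalars] using hasSum_qPoch hq z
  exact this.analyticAt

theorem taylorCoeff_qPoch (hq : ‖q‖ < 1) : taylorCoeff (fun x => qPoch x q) = eulerCoeff q :=
  taylorCoeff_eq (Eventually.of_forall fun z => hasSum_qPoch hq z)

theorem qPoch_zero : qPoch 0 q = 1 := by simp [qPoch]

end

section

/-! ### A sufficient condition for membership in the domain -/

variable {b : ℂ} {k : ℤ}

/-- Superexponential decay of the iterates of the two shift operators. -/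
def Admissible (b : ℂ) (k : ℤ) (S : Fn) : Prop :=
  ∀ L : ℝ, 0 < L → ∀ r : ℝ, ∃ C : ℝ, ∀ (m n : ℕ) (x : Coord → ℂ), ‖x‖ ≤ r →
    ‖nome b‖ ^ (m.choose 2) * ‖((shiftX b k)^[m] ((shiftXt b k)^[n] S)) x‖ ≤ C * L ^ (m + n)

theorem iterate_shiftX_tsum (a : ℕ → ℂ) (F : ℕ → Fn) (m : ℕ) :
    (shiftX b k)^[m] (fun x => ∑' n, a n * F n x)
      = fun x => ∑' n, a n * ((shiftX b k)^[m] (F n)) x := by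
  induction m with
  | zero => rfl
  | succ m ih =>
    simp only [Function.iterate_succ_apply', ih]
    ext x
    simp only [shiftX, ← tsum_mul_left]
    exact tsum_congr fun n => by ring

theorem iterate_shiftXt_tsum (a : ℕ → ℂ) (F : ℕ → Fn) (m : ℕ) :
    (shiftXt b k)^[m] (fun x => ∑' n, a n * F n x)
      = fun x => ∑' n, a n * ((shiftXt b k)^[m] (F n)) x := by
  induction m with
  | zero => rfl
  | succ m ih =>
    simp only [Function.iterate_succ_apply', ih]
    ext x
    simp only [shiftXt, ← tsum_mul_left]
    exact tsum_congr fun n => by ring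

theorem Admissible.exists_bound {S : Fn} (hS : Admissible b k S) {L : ℝ} (hL : 0 < L) (r : ℝ) :
    ∃ C : ℝ, 0 ≤ C ∧ ∀ (m n : ℕ) (x : Coord → ℂ), ‖x‖ ≤ r →
      ‖nome b‖ ^ (m.choose 2) * ‖((shiftX b k)^[m] ((shiftXt b k)^[n] S)) x‖
        ≤ C * L ^ m * L ^ n := by
  obtain ⟨C, hC⟩ := hS L hL r
  refine ⟨max C 0, le_max_right _ _, fun m n x hx => (hC m n x hx).trans ?_⟩
  rw [pow_add, mul_assoc]
  gcongr
  exact le_max_left _ _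

theorem norm_mul_le_geometric {A C ρ L : ℝ} (hA : 0 ≤ A) (hC : 0 ≤ C) (hρ : 0 ≤ ρ) (hL : 0 ≤ L)
    (hρL : ρ * L ≤ 1 / 2) {n : ℕ} {a g : ℂ} (ha : ‖a‖ ≤ A * ρ ^ n) (hg : ‖g‖ ≤ C * L ^ n) :
    ‖a * g‖ ≤ A * C * (1 / 2) ^ n :=
  calc ‖a * g‖ ≤ A * ρ ^ n * (C * L ^ n) := by rw [norm_mul]; gcongr
    _ = A * C * (ρ * L) ^ n := by rw [mul_pow]; ring
    _ ≤ _ := by gcongr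

theorem norm_tsum_le_geometric {A C ρ L : ℝ} (hA : 0 ≤ A) (hC : 0 ≤ C) (hρ : 0 ≤ ρ) (hL : 0 ≤ L)
    (hρL : ρ * L ≤ 1 / 2) {a g : ℕ → ℂ} (ha : ∀ n, ‖a n‖ ≤ A * ρ ^ n)
    (hg : ∀ n, ‖g n‖ ≤ C * L ^ n) : ‖∑' n, a n * g n‖ ≤ 2 * (A * C) := by
  have := tsum_of_norm_bounded (hasSum_geometric_two.mul_left (A * C))
    fun n => norm_mul_le_geometric hA hC hρ hL hρL (ha n) (hg n)
  linarith

/-- Absolute convergence permits summation along antidiagonals, where the coefficients of h and 1/h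
cancel except at total degree 0. -/
theorem tsum_tsum_taylorCoeff_inv {h : ℂ → ℂ} (hh : AnalyticAt ℂ h 0) (h0 : h 0 ≠ 0)
    {F : ℕ → ℂ} (hs : Summable fun p : ℕ × ℕ =>
      taylorCoeff h p.1 * (taylorCoeff (fun z => (h z)⁻¹) p.2 * F (p.1 + p.2))) :
    ∑' m, taylorCoeff h m * ∑' n, taylorCoeff (fun z => (h z)⁻¹) n * F (m + n) = F 0 := by
  simp only [← tsum_mul_left]
  rw [← hs.tsum_prod, ← Finset.HasAntidiagonal.sigmaAntidiagonalEquivProd.tsum_eq]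
  have hs' := Finset.HasAntidiagonal.sigmaAntidiagonalEquivProd.summable_iff.2 hs
  refine hs'.tsum_sigma.trans ?_
  have hN : ∀ n, ∑' p : Finset.HasAntidiagonal.antidiagonal n,
      ((fun p : ℕ × ℕ => taylorCoeff h p.1 *
        (taylorCoeff (fun z => (h z)⁻¹) p.2 * F (p.1 + p.2))) ∘
          Finset.HasAntidiagonal.sigmaAntidiagonalEquivProd) ⟨n, p⟩
      = (if n = 0 then 1 else 0) * F n := by
    intro n
    rw [← sum_taylorCoeff_mul_inv hh h0 n, Finset.sum_mul, tsum_fintype]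
    refine Eq.trans (Finset.sum_congr rfl fun p _ => ?_)
      (Finset.sum_coe_sort (Finset.HasAntidiagonal.antidiagonal n) fun p : ℕ × ℕ =>
        taylorCoeff h p.1 * taylorCoeff (fun z => (h z)⁻¹) p.2 * F n)
    have := Finset.HasAntidiagonal.mem_antidiagonal.1 p.2
    simp [this, mul_assoc]
  rw [tsum_congr hN, tsum_eq_single 0 fun n hn => by simp [hn]]
  simp

theorem norm_nome_lt_one (hb : 0 < (b ^ 2).im) : ‖nome b‖ < 1 := by
  have h0 : b ^ 2 ≠ 0 := fun h => by simp [h] at hb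
  rw [nome, norm_exp, Real.exp_lt_one_iff]
  have : ((b ^ 2)⁻¹).im < 0 := by
    rw [inv_im]
    exact div_neg_of_neg_of_pos (by linarith) (normSq_pos.2 h0)
  have h2 : (-(2 * (Real.pi : ℂ) * I * (b ^ 2)⁻¹)).re = 2 * Real.pi * ((b ^ 2)⁻¹).im := by
    generalize (b ^ 2)⁻¹ = a
    simp
  rw [h2]
  exact mul_neg_of_pos_of_neg (by positivity) this

theorem Admissible.exists_apply (hb : 0 < (b ^ 2).im) {S : Fn} (eS : Entire S)
    (hS : Admissible b k S) : ∃ Q R : Fn, PsiBarInvApply b k S Q ∧ PsiApply b k Q R := by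
  have hb0 : b ≠ 0 := fun h => by simp [h] at hb
  have hq := norm_nome_lt_one hb
  have hq' : ‖conj (nome b)‖ < 1 := by rwa [RCLike.norm_conj]
  set h : ℂ → ℂ := fun x => qPoch x (conj (nome b)) with hh
  have han : AnalyticAt ℂ h 0 := analyticAt_qPoch hq'
  have hh0 : h 0 ≠ 0 := by simp [hh, qPoch_zero]
  obtain ⟨A, hA, ρ, hρ, ha⟩ := exists_norm_taylorCoeff_le (han.inv hh0)
  obtain ⟨B, hB, σ, hσ, hbd⟩ := exists_norm_taylorCoeff_le han
  set a := taylorCoeff (fun z => (h z)⁻¹) with hadef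
  replace ha : ∀ n, ‖a n‖ ≤ A * ρ ^ n := ha
  set K := (1 - ‖nome b‖)⁻¹ with hK
  have hK0 : 0 < K := inv_pos.2 (by linarith)
  -- ρ, σ and K are the geometric rates of the coefficients of 1/Ψ̄, Ψ̄ and, apart from the nome
  -- weight, Ψ. This L makes every series below dominated by powers of 1/2.
  set L : ℝ := min (1 / (2 * ρ)) (min (1 / (2 * σ)) (1 / (2 * K))) with hLdef
  have hL : 0 < L := by positivity
  have hLρ : ρ * L ≤ 1 / 2 := by
    calc ρ * L ≤ ρ * (1 / (2 * ρ)) := by gcongr; exact min_le_left _ _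
      _ = 1 / 2 := by field_simp
  have hLσ : σ * L ≤ 1 / 2 := by
    calc σ * L ≤ σ * (1 / (2 * σ)) := by
          gcongr; exact (min_le_right _ _).trans (min_le_left _ _)
      _ = 1 / 2 := by field_simp
  have hLK : K * L ≤ 1 / 2 := by
    calc K * L ≤ K * (1 / (2 * K)) := by
          gcongr; exact (min_le_right _ _).trans (min_le_right _ _)
      _ = 1 / 2 := by field_simp
  have hgeo : ∀ c : ℝ, Summable fun n : ℕ => c * (1 / 2) ^ n := fun c =>
    summable_geometric_two.mul_left c
  have hXt : ∀ r, ∃ C, 0 ≤ C ∧ ∀ (n : ℕ) (x : Coord → ℂ), ‖x‖ ≤ r →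
      ‖((shiftXt b k)^[n] S) x‖ ≤ C * L ^ n := fun r => by
    obtain ⟨C, hC0, hC⟩ := hS.exists_bound hL r
    exact ⟨C, hC0, fun n x hx => by simpa using hC 0 n x hx⟩
  set Q : Fn := fun x => ∑' n, a n * ((shiftXt b k)^[n] S) x with hQ
  have hsQ : HasSumLocallyUniformly (fun n x => a n * ((shiftXt b k)^[n] S) x) Q := by
    refine hasSumLocallyUniformly_of_bound fun r => ?_
    obtain ⟨C, hC0, hC⟩ := hXt r
    exact ⟨_, hgeo (A * C), fun n x hx =>
      norm_mul_le_geometric hA.le hC0 hρ.le hL.le hLρ (ha n) (hC n x hx)⟩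
  have eQ : Entire Q := Entire.of_hasSumLocallyUniformly
    (fun n => contDiff_const.mul (eS.iterate_shiftXt k n)) hsQ
  have hQt : ∀ m, (shiftXt b k)^[m] Q
      = fun x => ∑' n, a n * ((shiftXt b k)^[m + n] S) x := fun m => by
    rw [hQ, iterate_shiftXt_tsum]
    simp only [← Function.iterate_add_apply]
  have hQx : ∀ m, (shiftX b k)^[m] Q
      = fun x => ∑' n, a n * ((shiftX b k)^[m] ((shiftXt b k)^[n] S)) x := fun m => by
    rw [hQ, iterate_shiftX_tsum]
  refine ⟨Q, fun x => ∑' m, taylorCoeff (fun x => qPoch x (nome b)) m * ((shiftX b k)^[m] Q) x,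
    ⟨?_, ?_⟩, ?_⟩
  · simp only [PowerSeriesApply, iterate_opXt_eq k hb0 eS]
    exact hsQ
  · simp only [PsiBarApply, PowerSeriesApply, iterate_opXt_eq k hb0 eQ]
    convert! hasSumLocallyUniformly_of_bound
      (f := fun m x => taylorCoeff h m * ((shiftXt b k)^[m] Q) x) ?_ using 1
    · ext x
      simp only [hQt]
      obtain ⟨C, hC0, hC⟩ := hXt ‖x‖
      rw [tsum_tsum_taylorCoeff_inv han hh0 (F := fun n => ((shiftXt b k)^[n] S) x)]
      · rfl
      · refine Summable.of_norm_bounded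
          ((hgeo B).mul_of_nonneg (hgeo (A * C)) (fun n => by positivity)
            fun n => by positivity) fun p => ?_
        have h1 := norm_mul_le_geometric (n := p.1) (g := ((L ^ p.1 : ℝ) : ℂ)) hB.le one_pos.le
          hσ.le hL.le hLσ (hbd p.1) (by simp [abs_of_pos hL])
        have h2 := norm_mul_le_geometric (n := p.2) (g := ((C * L ^ p.2 : ℝ) : ℂ)) hA.le hC0
          hρ.le hL.le hLρ (ha p.2) (by simp [abs_of_pos hL, abs_of_nonneg hC0])
        have h3 := hC (p.1 + p.2) x le_rfl
        rw [norm_mul, norm_real, Real.norm_of_nonneg (by positivity)] at h1 h2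
        rw [norm_mul, norm_mul]
        rw [mul_one] at h1
        calc ‖taylorCoeff h p.1‖ * (‖a p.2‖ * ‖((shiftXt b k)^[p.1 + p.2] S) x‖)
            ≤ ‖taylorCoeff h p.1‖ * (‖a p.2‖ * (C * L ^ (p.1 + p.2))) := by gcongr
          _ = (‖taylorCoeff h p.1‖ * L ^ p.1) * (‖a p.2‖ * (C * L ^ p.2)) := by
            rw [pow_add]; ring
          _ ≤ _ := by gcongr
    · intro r
      obtain ⟨C, hC0, hC⟩ := hXt r
      refine ⟨_, hgeo (B * (2 * (A * C))), fun m x hx => ?_⟩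
      refine norm_mul_le_geometric hB.le (by positivity) hσ.le hL.le hLσ (hbd m) ?_
      rw [hQt]
      have := norm_tsum_le_geometric (C := C * L ^ m) hA.le (by positivity) hρ.le hL.le hLρ ha
        (g := fun n => ((shiftXt b k)^[m + n] S) x)
        fun n => (hC (m + n) x hx).trans (by rw [pow_add]; linarith)
      linarith
  · simp only [PsiApply, PowerSeriesApply, iterate_opX_eq k hb0 eQ]
    refine hasSumLocallyUniformly_of_bound
      (f := fun m x => taylorCoeff (fun x => qPoch x (nome b)) m * ((shiftX b k)^[m] Q) x)
      fun r => ?_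
    obtain ⟨C, hC0, hC⟩ := hS.exists_bound hL r
    refine ⟨_, hgeo (2 * (A * C)), fun m x hx => ?_⟩
    rw [taylorCoeff_qPoch hq, hQx, ← tsum_mul_left]
    simp only [mul_left_comm (eulerCoeff (nome b) m)]
    have := norm_tsum_le_geometric (C := C * (1 / 2) ^ m) hA.le (by positivity) hρ.le hL.le hLρ ha
        (g := fun n => eulerCoeff (nome b) m * ((shiftX b k)^[m] ((shiftXt b k)^[n] S)) x)
        fun n => ?_
    · linarith
    · rw [norm_mul]
      calc _ ≤ (K ^ m * ‖nome b‖ ^ (m.choose 2))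
              * ‖((shiftX b k)^[m] ((shiftXt b k)^[n] S)) x‖ := by
            gcongr; exact norm_eulerCoeff_le hq m
        _ ≤ K ^ m * (C * L ^ m * L ^ n) := by
            rw [mul_assoc]; exact mul_le_mul_of_nonneg_left (hC m n x hx) (by positivity)
        _ = C * (K * L) ^ m * L ^ n := by rw [mul_pow]; ring
        _ ≤ _ := by gcongr

end

section

/-! ### Quadratic forms -/

/-- The standard symplectic form. -/
def omega {R : Type} [CommRing R] (x y : Coord → R) : R :=
  (x (0, 1) * y (0, 0) - x (0, 0) * y (0, 1)) + (x (1, 1) * y (1, 0) - x (1, 0) * y (1, 1))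

/-- The real part of `b⁻²`. -/
def alphaR (b : ℂ) : ℝ := ((b ^ 2)⁻¹).re

/-- Minus the imaginary part of `b⁻²`. -/
def betaR (b : ℂ) : ℝ := -((b ^ 2)⁻¹).im

/-- The coefficient of the mixed term in the quadratic form `qR`. -/
def kappaR (b : ℂ) (k : ℤ) : ℝ := 1 - k * alphaR b

/-- The quadratic form on the first pair of coordinates. -/
def planeForm (κ u v : ℝ) : ℝ := 3 / 2 * v ^ 2 - 2 * κ * (v * u) + 5 / 6 * u ^ 2

/-- The weight of `v₂'` in the quadratic form `qR`. -/
def weightV (b : ℂ) (k : ℤ) : ℝ := 20 * betaR b * k ^ 2 + 1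

/-- The real quadratic form of the Gaussian kernel. -/
def qR (b : ℂ) (k : ℤ) (x : Coord → ℝ) : ℝ :=
  Real.pi * (planeForm (kappaR b k) (x (0, 0)) (x (0, 1)) / betaR b
    + (1 / (24 * betaR b) * x (1, 0) ^ 2 + weightV b k * x (1, 1) ^ 2))

/-- The complex extension of `qR`. -/
def qC (b : ℂ) (k : ℤ) (x : Coord → ℂ) : ℂ :=
  Real.pi * ((3 / 2 * x (0, 1) ^ 2 - 2 * kappaR b k * (x (0, 1) * x (0, 0))
    + 5 / 6 * x (0, 0) ^ 2) / betaR b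
    + (1 / (24 * betaR b) * x (1, 0) ^ 2 + weightV b k * x (1, 1) ^ 2))

/-- The growth exponent of the smoothed sections. -/
def growthR (b : ℂ) (k : ℤ) (C : ℝ) (x : Coord → ℝ) : ℝ :=
  Real.pi * (planeForm (kappaR b k) (x (0, 0)) (x (0, 1)) / betaR b
    + 1 / (12 * betaR b) * x (1, 0) ^ 2 + C * x (1, 1) ^ 2)

theorem planeForm_lower {κ : ℝ} (hκ : κ ^ 2 ≤ 1) (u v : ℝ) :
    1 / 12 * (u ^ 2 + v ^ 2) ≤ planeForm κ u v := by
  obtain ⟨h1, h2⟩ := abs_le.1 ((sq_le_one_iff_abs_le_one κ).1 hκ)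
  -- 24 times `planeForm` is the sum of the expressions in `h3` and `h4` plus 4v² + 2u².
  have h3 : 0 ≤ (1 + κ) * (4 * v - 3 * u) ^ 2 := mul_nonneg (by linarith) (sq_nonneg _)
  have h4 : 0 ≤ (1 - κ) * (4 * v + 3 * u) ^ 2 := mul_nonneg (by linarith) (sq_nonneg _)
  unfold planeForm
  linarith [sq_nonneg v]

/-- `planeForm` has determinant 5/4 - κ², so Lagrange's identity bounds (5/4 - κ²) times the squared
area by the product of the two values, and τ² = 1 - κ² ≤ 4/5 (5/4 - κ²). The claim follows by AM–GM,
as 4(1 - A)(A - 1/20) ≥ 4/5 on the window. The reserved 1/20 later pays for Gaussian decay. -/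
theorem planeForm_symplectic {κ τ A : ℝ} (hκ : κ ^ 2 + τ ^ 2 = 1) (hA : A ∈ Icc (2 / 5) (1 / 2))
    (u v u' v' : ℝ) : |τ * (v * u' - u * v')|
      ≤ (1 - A) * planeForm κ u v + (A - 1 / 20) * planeForm κ u' v' := by
  have hκ1 : κ ^ 2 ≤ 1 := by nlinarith [sq_nonneg τ]
  have hP : 0 ≤ planeForm κ u v := (by positivity : (0:ℝ) ≤ _).trans (planeForm_lower hκ1 u v)
  have hZ : 0 ≤ planeForm κ u' v' := (by positivity : (0:ℝ) ≤ _).trans (planeForm_lower hκ1 u' v')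
  have hdet : (5 / 4 - κ ^ 2) * (v * u' - u * v') ^ 2 ≤ planeForm κ u v * planeForm κ u' v' := by
    have : planeForm κ u v * planeForm κ u' v' - (5 / 4 - κ ^ 2) * (v * u' - u * v') ^ 2
        = (3 / 2 * v * v' - κ * (v * u' + u * v') + 5 / 6 * u * u') ^ 2 := by
      unfold planeForm; ring
    nlinarith [sq_nonneg (3 / 2 * v * v' - κ * (v * u' + u * v') + 5 / 6 * u * u')]
  have hW : (τ * (v * u' - u * v')) ^ 2 ≤ 4 / 5 * (planeForm κ u v * planeForm κ u' v') := by
    nlinarith [mul_nonneg (sq_nonneg κ) (sq_nonneg (v * u' - u * v'))]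
  generalize planeForm κ u v = P at *
  generalize planeForm κ u' v' = Z at *
  obtain ⟨hA1, hA2⟩ := hA
  refine abs_le_of_sq_le_sq (hW.trans ?_) (by nlinarith)
  have h4 : 4 / 5 ≤ 4 * ((1 - A) * (A - 1 / 20)) := by nlinarith
  nlinarith [sq_nonneg ((1 - A) * P - (A - 1 / 20) * Z), mul_nonneg hP hZ]

theorem sum_coord {R : Type} [AddCommMonoid R] (f : Coord → R) :
    ∑ j, f j = (f (0, 0) + f (0, 1)) + (f (1, 0) + f (1, 1)) := by
  rw [Fintype.sum_prod_type]
  simp [Fin.sum_univ_two]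

section Params

variable {b : ℂ} {k : ℤ}

theorem betaR_pos (hb : 0 < (b ^ 2).im) : 0 < betaR b := by
  have h0 : b ^ 2 ≠ 0 := fun h => by simp [h] at hb
  rw [betaR, inv_im, neg_div, neg_neg]
  exact div_pos hb (normSq_pos.2 h0)

theorem inv_sq_eq : (b ^ 2)⁻¹ = alphaR b - betaR b * I := by
  rw [alphaR, betaR]
  generalize (b ^ 2)⁻¹ = a
  apply Complex.ext <;> simp

theorem conj_inv_sq_eq : (conj b ^ 2)⁻¹ = alphaR b + betaR b * I := by
  rw [← map_pow, ← map_inv₀, inv_sq_eq]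
  simp

theorem level_eq (hb : 0 < (b ^ 2).im) (hk : 2 * (b ^ 2).re = (k : ℝ)) :
    k * (alphaR b ^ 2 + betaR b ^ 2) = 2 * alphaR b := by
  have h0 : b ^ 2 ≠ 0 := fun h => by simp [h] at hb
  have h1 := normSq_pos.2 h0
  rw [alphaR, betaR, inv_re, inv_im, ← hk]
  field_simp
  rw [normSq_apply]
  ring

/-- This is |1 - k b⁻²| = 1, which holds because b² - k = -b̄². -/
theorem kappaR_sq (hb : 0 < (b ^ 2).im) (hk : 2 * (b ^ 2).re = (k : ℝ)) :
    kappaR b k ^ 2 + (k * betaR b) ^ 2 = 1 := by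
  have := level_eq hb hk
  rw [kappaR]
  linear_combination k * this

theorem weightV_pos (hb : 0 < (b ^ 2).im) : 0 < weightV b k := by
  have := betaR_pos hb
  unfold weightV
  positivity

theorem exists_qR_lower (hb : 0 < (b ^ 2).im) (hk : 2 * (b ^ 2).re = (k : ℝ)) :
    ∃ c > 0, ∀ y, c * ∑ j, y j ^ 2 ≤ qR b k y := by
  have hβ := betaR_pos hb
  have hw := weightV_pos (k := k) hb
  have hκ : kappaR b k ^ 2 ≤ 1 := by nlinarith [kappaR_sq hb hk, sq_nonneg (k * betaR b)]
  refine ⟨Real.pi * min (1 / (24 * betaR b)) (weightV b k), by positivity, fun y => ?_⟩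
  rw [sum_coord, qR, mul_assoc]
  refine mul_le_mul_of_nonneg_left ?_ Real.pi_pos.le
  set c := min (1 / (24 * betaR b)) (weightV b k)
  have h1 : c ≤ 1 / (24 * betaR b) := min_le_left _ _
  have h2 : c ≤ weightV b k := min_le_right _ _
  have h3 : c * (y (0, 0) ^ 2 + y (0, 1) ^ 2)
      ≤ planeForm (kappaR b k) (y (0, 0)) (y (0, 1)) / betaR b := by
    rw [le_div_iff₀ hβ]
    refine le_trans ?_ (planeForm_lower hκ _ _)
    have : c * betaR b ≤ 1 / 12 := by
      calc c * betaR b ≤ 1 / (24 * betaR b) * betaR b := by gcongr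
        _ = 1 / 24 := by field_simp
        _ ≤ _ := by norm_num
    nlinarith [sq_nonneg (y (0, 0)), sq_nonneg (y (0, 1))]
  have h4 : c * y (1, 0) ^ 2 ≤ 1 / (24 * betaR b) * y (1, 0) ^ 2 := by gcongr
  have h5 : c * y (1, 1) ^ 2 ≤ weightV b k * y (1, 1) ^ 2 := by gcongr
  linarith

/-- The key estimate: the exponent of the Gaussian kernel is dominated by `growthR`. -/
theorem exists_exponent_le (hb : 0 < (b ^ 2).im) (hk : 2 * (b ^ 2).re = (k : ℝ)) :
    ∃ δ > 0, ∃ C, ∀ A ∈ Icc (2 / 5 : ℝ) (1 / 2), ∀ p z : Coord → ℝ,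
      -A * qR b k z + A * qR b k p - Real.pi * k * omega p z
        ≤ growthR b k C p - δ * ∑ j, z j ^ 2 := by
  have hβ := betaR_pos hb
  have hw := weightV_pos (k := k) hb
  have hκ2 := kappaR_sq hb hk
  have hκ : kappaR b k ^ 2 ≤ 1 := by nlinarith [sq_nonneg (k * betaR b)]
  set κ := kappaR b k
  set β := betaR b
  set w := weightV b k with hwdef
  -- 1/240 is the reserve 1/20 times the lower bound 1/12 of `planeForm`; the other two bounds serve
  -- the second plane.
  obtain ⟨δ, hδ, h1, h2, h3⟩ : ∃ δ > 0, δ ≤ 1 / (240 * β) ∧ δ ≤ 1 / (120 * β) ∧ δ ≤ w / 5 :=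
    ⟨min (1 / (240 * β)) (w / 5), by positivity, min_le_left _ _,
      (min_le_left _ _).trans (by gcongr; norm_num), min_le_right _ _⟩
  refine ⟨Real.pi * δ, by positivity, w + 60 * β * k ^ 2, fun A hA p z => ?_⟩
  obtain ⟨hA1, hA2⟩ := hA
  rw [sum_coord]
  have hplane := planeForm_symplectic hκ2 ⟨hA1, hA2⟩ (p (0, 0)) (p (0, 1)) (z (0, 0)) (z (0, 1))
  have hlow := planeForm_lower hκ (z (0, 0)) (z (0, 1))
  set P := planeForm κ (p (0, 0)) (p (0, 1)) with hP
  set Z := planeForm κ (z (0, 0)) (z (0, 1)) with hZ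
  have e1 : -A * (Z / β) + A * (P / β)
      - k * (p (0, 1) * z (0, 0) - p (0, 0) * z (0, 1))
      ≤ P / β - δ * (z (0, 0) ^ 2 + z (0, 1) ^ 2) := by
    have h := (abs_le.1 hplane).1
    have hδ' : δ * (z (0, 0) ^ 2 + z (0, 1) ^ 2) ≤ 1 / 20 * Z / β := by
      rw [le_div_iff₀ hβ]
      have : δ * β ≤ 1 / 240 := by
        calc δ * β ≤ 1 / (240 * β) * β := by gcongr
          _ = 1 / 240 := by field_simp
      nlinarith [sq_nonneg (z (0, 0)), sq_nonneg (z (0, 1))]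
    have h' : -(k * (p (0, 1) * z (0, 0) - p (0, 0) * z (0, 1)))
        ≤ ((1 - A) * P + (A - 1 / 20) * Z) / β := by
      rw [le_div_iff₀ hβ]; linarith
    have h'' : ((1 - A) * P + (A - 1 / 20) * Z) / β
      = (1 - A) * (P / β) + A * (Z / β) - 1 / 20 * Z / β := by ring
    linarith
  -- In the second plane the cross terms are absorbed by completing squares. The u₂ budget is 1/48 +
  -- 1/16 = 1/12; the v₂ coefficient may be large, since neither shift moves v₂.
  have e2 : -A * (1 / (24 * β) * z (1, 0) ^ 2 + w * z (1, 1) ^ 2)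
      + A * (1 / (24 * β) * p (1, 0) ^ 2 + w * p (1, 1) ^ 2)
      - k * (p (1, 1) * z (1, 0) - p (1, 0) * z (1, 1))
      ≤ 1 / (12 * β) * p (1, 0) ^ 2 + (w + 60 * β * k ^ 2) * p (1, 1) ^ 2
        - δ * (z (1, 0) ^ 2 + z (1, 1) ^ 2) := by
    have i1 : -(k * (p (1, 1) * z (1, 0)))
        ≤ 1 / (240 * β) * z (1, 0) ^ 2 + 60 * β * k ^ 2 * p (1, 1) ^ 2 := by
      have : 1 / (240 * β) * z (1, 0) ^ 2 + 60 * β * k ^ 2 * p (1, 1) ^ 2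
          + k * (p (1, 1) * z (1, 0))
          = 1 / (240 * β) * (z (1, 0) + 120 * β * k * p (1, 1)) ^ 2 := by
        field_simp
        ring
      have h0 : 0 ≤ 1 / (240 * β) * (z (1, 0) + 120 * β * k * p (1, 1)) ^ 2 := by positivity
      linarith
    have i2 : k * (p (1, 0) * z (1, 1)) ≤ w / 5 * z (1, 1) ^ 2 + 1 / (16 * β) * p (1, 0) ^ 2 := by
      have : 4 * β * k ^ 2 ≤ w / 5 := by rw [hwdef, weightV]; linarith
      have h0 : 4 * β * k ^ 2 * z (1, 1) ^ 2 ≤ w / 5 * z (1, 1) ^ 2 := by gcongr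
      have h1 : 4 * β * k ^ 2 * z (1, 1) ^ 2 + 1 / (16 * β) * p (1, 0) ^ 2
          - k * (p (1, 0) * z (1, 1))
          = 1 / (16 * β) * (p (1, 0) - 8 * β * k * z (1, 1)) ^ 2 := by
        field_simp
        ring
      have h2 : 0 ≤ 1 / (16 * β) * (p (1, 0) - 8 * β * k * z (1, 1)) ^ 2 := by positivity
      linarith
    have j1 : δ * z (1, 0) ^ 2 ≤ 1 / (120 * β) * z (1, 0) ^ 2 := by gcongr
    have j2 : δ * z (1, 1) ^ 2 ≤ w / 5 * z (1, 1) ^ 2 := by gcongr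
    have j3 : 2 / 5 * (1 / (24 * β) * z (1, 0) ^ 2 + w * z (1, 1) ^ 2)
        ≤ A * (1 / (24 * β) * z (1, 0) ^ 2 + w * z (1, 1) ^ 2) := by gcongr
    have j4 : A * (1 / (24 * β) * p (1, 0) ^ 2 + w * p (1, 1) ^ 2)
        ≤ 1 / 2 * (1 / (24 * β) * p (1, 0) ^ 2 + w * p (1, 1) ^ 2) := by gcongr
    have hwp : 0 ≤ w * p (1, 1) ^ 2 := by positivity
    have hz : 1 / (240 * β) * z (1, 0) ^ 2 = 1 / 240 * (z (1, 0) ^ 2 / β) := by field_simp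
    have hz1 : 1 / (120 * β) * z (1, 0) ^ 2 = 1 / 120 * (z (1, 0) ^ 2 / β) := by field_simp
    have hz2 : 1 / (24 * β) * z (1, 0) ^ 2 = 1 / 24 * (z (1, 0) ^ 2 / β) := by field_simp
    have hp1 : 1 / (16 * β) * p (1, 0) ^ 2 = 1 / 16 * (p (1, 0) ^ 2 / β) := by field_simp
    have hp2 : 1 / (24 * β) * p (1, 0) ^ 2 = 1 / 24 * (p (1, 0) ^ 2 / β) := by field_simp
    have hp3 : 1 / (12 * β) * p (1, 0) ^ 2 = 1 / 12 * (p (1, 0) ^ 2 / β) := by field_simp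
    have hzn : 0 ≤ z (1, 0) ^ 2 / β := by positivity
    rw [hz] at i1
    rw [hp1] at i2
    rw [hz1] at j1
    rw [hz2] at j3 ⊢
    rw [hp2] at j4 ⊢
    rw [hp3]
    linarith
  have := mul_le_mul_of_nonneg_left (add_le_add e1 e2) Real.pi_pos.le
  rw [qR, qR, growthR, omega, ← hP, ← hZ]
  linarith

end Params

end

section

/-! ### Growth implies admissibility -/

/-- The coordinatewise real part. -/
def rePart (x : Coord → ℂ) : Coord → ℝ := fun j => (x j).re

/-- The coordinatewise imaginary part. -/
def imPart (x : Coord → ℂ) : Coord → ℝ := fun j => (x j).im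

section

variable {b : ℂ} {k : ℤ}

theorem iterate_shiftX_apply (S : Fn) (m : ℕ) (x : Coord → ℂ) :
    ((shiftX b k)^[m] S) x
      = exp (m * multX b k x - Real.pi * I * (b ^ 2)⁻¹ * (m * (m - 1)))
        * S (x + (m : ℂ) • shX b) := by
  induction m generalizing x with
  | zero => simp
  | succ m ih =>
    rw [Function.iterate_succ_apply', shiftX, ih, ← mul_assoc, ← exp_add]
    have h1 : multX b k (x + shX b) = multX b k x - 2 * Real.pi * I * (b ^ 2)⁻¹ := by
      simp [multX, shX]
      ring
    rw [h1]
    congr 2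
    · push_cast
      ring
    · push_cast
      rw [add_smul, one_smul]
      abel

theorem iterate_shiftXt_apply (S : Fn) (n : ℕ) (x : Coord → ℂ) :
    ((shiftXt b k)^[n] S) x
      = exp (n * multXt b k x + Real.pi * I * (conj b ^ 2)⁻¹ * (n * (n - 1)))
        * S (x + (n : ℂ) • shXt b) := by
  induction n generalizing x with
  | zero => simp
  | succ m ih =>
    rw [Function.iterate_succ_apply', shiftXt, ih, ← mul_assoc, ← exp_add]
    have h1 : multXt b k (x + shXt b) = multXt b k x + 2 * Real.pi * I * (conj b ^ 2)⁻¹ := by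
      simp [multXt, shXt]
      ring
    rw [h1]
    congr 2
    · push_cast
      ring
    · push_cast
      rw [add_smul, one_smul]
      abel

theorem norm_nome : ‖nome b‖ = Real.exp (-(2 * Real.pi * betaR b)) := by
  rw [nome, norm_exp, inv_sq_eq]
  simp

/-- The exponent that controls the iterated shifts. -/
def shiftExponent (b : ℂ) (k : ℤ) (C μ ν : ℝ) (x : Coord → ℂ) : ℝ :=
  -(Real.pi * betaR b * (μ * (μ - 1)))
    + (μ * multX b k x - Real.pi * I * (b ^ 2)⁻¹ * (μ * (μ - 1))).re
    + (ν * multXt b k (x + (μ : ℂ) • shX b)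
        + Real.pi * I * (conj b ^ 2)⁻¹ * (ν * (ν - 1))).re
    + (-(Real.pi * k * omega (imPart (x + (μ : ℂ) • shX b + (ν : ℂ) • shXt b))
          (rePart (x + (μ : ℂ) • shX b + (ν : ℂ) • shXt b)))
        + growthR b k C (imPart (x + (μ : ℂ) • shX b + (ν : ℂ) • shXt b)))

/-- The exponent is quadratic in (μ, ν). In units of πβ, the μ² coefficient is 3/2 from growth, -1
from the multiplier and -1 from the nome weight; the ν² coefficient is 5/6 + 1/12 from growth and -1
from the multiplier. The mixed term vanishes exactly because κ = 1 - kα. These requirements dictate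
the coefficients of `planeForm` and `growthR`. -/
theorem shiftExponent_eq (hb : 0 < (b ^ 2).im) (C μ ν : ℝ) (x : Coord → ℂ) :
    shiftExponent b k C μ ν x = shiftExponent b k C 0 0 x
      + μ * (shiftExponent b k C 1 0 x - shiftExponent b k C 0 0 x + Real.pi * betaR b / 2)
      + ν * (shiftExponent b k C 0 1 x - shiftExponent b k C 0 0 x + Real.pi * betaR b / 12)
      - Real.pi * betaR b * (μ ^ 2 / 2 + ν ^ 2 / 12) := by
  have hβ := (betaR_pos hb).ne'
  simp [shiftExponent, omega, growthR, planeForm, imPart, rePart, shX, shXt, multX, multXt,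
    inv_sq_eq (b := b), conj_inv_sq_eq, kappaR]
  field_simp
  ring

theorem continuous_shiftExponent (C μ ν : ℝ) : Continuous (shiftExponent b k C μ ν) := by
  unfold shiftExponent omega growthR planeForm imPart rePart multX multXt
  simp only [Pi.add_apply, Pi.smul_apply]
  fun_prop

theorem norm_iterate_le {S : Fn} {C₀ C : ℝ}
    (h : ∀ x, ‖S x‖ ≤ C₀ * Real.exp (-(Real.pi * k * omega (imPart x) (rePart x))
      + growthR b k C (imPart x))) (m n : ℕ) (x : Coord → ℂ) :
    ‖nome b‖ ^ (m.choose 2) * ‖((shiftX b k)^[m] ((shiftXt b k)^[n] S)) x‖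
      ≤ C₀ * Real.exp (shiftExponent b k C m n x) := by
  have h1 : ‖nome b‖ ^ (m.choose 2) = Real.exp (-(Real.pi * betaR b * (m * (m - 1)))) := by
    rw [norm_nome, ← Real.exp_nat_mul, Nat.cast_choose_two]
    congr 1
    ring
  rw [iterate_shiftX_apply, iterate_shiftXt_apply, norm_mul, norm_mul, norm_exp, norm_exp, h1]
  calc _ ≤ Real.exp (-(Real.pi * betaR b * (m * (m - 1))))
      * (Real.exp (m * multX b k x - Real.pi * I * (b ^ 2)⁻¹ * (m * (m - 1))).re
        * (Real.exp (n * multXt b k (x + (m : ℂ) • shX b)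
          + Real.pi * I * (conj b ^ 2)⁻¹ * (n * (n - 1))).re
          * (C₀ * Real.exp (-(Real.pi * k *
            omega (imPart (x + (m : ℂ) • shX b + (n : ℂ) • shXt b))
              (rePart (x + (m : ℂ) • shX b + (n : ℂ) • shXt b)))
            + growthR b k C (imPart (x + (m : ℂ) • shX b + (n : ℂ) • shXt b)))))) := by
        gcongr; exact h _
    _ = _ := by
        simp only [shiftExponent, Real.exp_add, ofReal_natCast]
        ring

theorem admissible_of_growth (hb : 0 < (b ^ 2).im) {S : Fn} {C₀ C : ℝ}
    (h : ∀ x, ‖S x‖ ≤ C₀ * Real.exp (-(Real.pi * k * omega (imPart x) (rePart x))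
      + growthR b k C (imPart x))) : Admissible b k S := by
  intro L hL r
  have hβ := betaR_pos hb
  have hC₀ : 0 ≤ C₀ := by
    have := (norm_nonneg _).trans (h 0)
    exact nonneg_of_mul_nonneg_left this (Real.exp_pos _)
  have hbd : ∀ f : (Coord → ℂ) → ℝ, Continuous f → ∃ D, ∀ x : Coord → ℂ, ‖x‖ ≤ r → f x ≤ D :=
    fun f hf => by
      obtain ⟨D, hD⟩ := (isCompact_closedBall (0 : Coord → ℂ) r).exists_bound_of_continuousOn
        hf.continuousOn
      exact ⟨D, fun x hx => (le_abs_self _).trans (hD x (by simpa using hx))⟩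
  have hT := fun μ ν => continuous_shiftExponent (b := b) (k := k) C μ ν
  obtain ⟨D₀, h0⟩ := hbd _ (hT 0 0)
  obtain ⟨D₁, h1⟩ := hbd _ (((hT 1 0).sub (hT 0 0)).add_const (Real.pi * betaR b / 2))
  obtain ⟨D₂, h2⟩ := hbd _ (((hT 0 1).sub (hT 0 0)).add_const (Real.pi * betaR b / 12))
  set c := Real.pi * betaR b with hc
  have hc0 : 0 < c := by positivity
  set l := Real.log L with hl
  refine ⟨C₀ * Real.exp (D₀ + (D₁ - l) ^ 2 / (2 * c) + 3 * (D₂ - l) ^ 2 / c), fun m n x hx => ?_⟩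
  refine (norm_iterate_le h m n x).trans ?_
  rw [mul_assoc]
  refine mul_le_mul_of_nonneg_left ?_ hC₀
  rw [← Real.exp_log (pow_pos hL (m + n)), ← Real.exp_add, Real.log_pow, ← hl]
  refine Real.exp_le_exp.2 ?_
  rw [shiftExponent_eq hb, ← hc]
  have e0 := h0 x hx
  have e1 := mul_le_mul_of_nonneg_left (h1 x hx) (Nat.cast_nonneg (α := ℝ) m)
  have e2 := mul_le_mul_of_nonneg_left (h2 x hx) (Nat.cast_nonneg (α := ℝ) n)
  -- `q1` and `q2` bound concave quadratics by their maxima; the logarithm `l` of the arbitrary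
  -- ratio L only shifts the linear coefficients.
  have q1 : m * (D₁ - l) - c * (m ^ 2 / 2) ≤ (D₁ - l) ^ 2 / (2 * c) := by
    rw [le_div_iff₀ (by positivity)]
    nlinarith [sq_nonneg (c * m - (D₁ - l))]
  have q2 : n * (D₂ - l) - c * (n ^ 2 / 12) ≤ 3 * (D₂ - l) ^ 2 / c := by
    rw [le_div_iff₀ (by positivity)]
    nlinarith [sq_nonneg (c * n - 6 * (D₂ - l))]
  push_cast
  simp only [Pi.sub_apply] at e1 e2
  linarith

end

end

/-! ### Laplace transforms are entire -/

theorem integrable_gaussian {c : ℝ} (hc : 0 < c) :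
    Integrable fun y : Coord → ℝ => Real.exp (-c * ∑ j, y j ^ 2) := by
  have := (GaussianFourier.integrable_cexp_neg_mul_sum_add (ι := Coord) (b := (c : ℂ))
    (by simpa using hc) 0).norm
  refine this.congr (Eventually.of_forall fun y => ?_)
  simp only [norm_exp]
  congr 1
  simp [← ofReal_pow, ← ofReal_sum, ← ofReal_mul]

/-- The coefficients of the power series at `0` of a Laplace transform. -/
def laplaceSeries (lam : (Coord → ℝ) → ((Coord → ℂ) →L[ℂ] ℂ)) (f : (Coord → ℝ) → ℂ) :
    FormalMultilinearSeries ℂ (Coord → ℂ) ℂ := fun n =>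
  ∫ y, ((n.factorial : ℂ)⁻¹ * f y) •
    (ContinuousMultilinearMap.mkPiAlgebraFin ℂ n ℂ).compContinuousLinearMap fun _ => lam y

section Laplace

variable {lam : (Coord → ℝ) → ((Coord → ℂ) →L[ℂ] ℂ)} {f : (Coord → ℝ) → ℂ}

theorem norm_laplace_term_le (y : Coord → ℝ) (n : ℕ) :
    ‖((n.factorial : ℂ)⁻¹ * f y) •
      (ContinuousMultilinearMap.mkPiAlgebraFin ℂ n ℂ).compContinuousLinearMap fun _ => lam y‖
      ≤ ‖f y‖ * (‖lam y‖ ^ n / n.factorial) := by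
  rw [norm_smul, norm_mul, norm_inv, norm_natCast]
  have h1 := ContinuousMultilinearMap.norm_compContinuousLinearMap_le
    (ContinuousMultilinearMap.mkPiAlgebraFin ℂ n ℂ) (fun _ => lam y)
  rw [ContinuousMultilinearMap.norm_mkPiAlgebraFin, one_mul, Finset.prod_const, Finset.card_univ,
    Fintype.card_fin] at h1
  calc _ ≤ (n.factorial : ℝ)⁻¹ * ‖f y‖ * ‖lam y‖ ^ n := by gcongr
    _ = _ := by ring

theorem integrable_laplace_term (hlam : Continuous lam) (hf : AEStronglyMeasurable f)
    (hint : ∀ r : ℝ, Integrable fun y => Real.exp (r * ‖lam y‖) * ‖f y‖) (n : ℕ) :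
    Integrable fun y => ((n.factorial : ℂ)⁻¹ * f y) •
      (ContinuousMultilinearMap.mkPiAlgebraFin ℂ n ℂ).compContinuousLinearMap fun _ => lam y := by
  refine (hint 1).mono' ?_ (Eventually.of_forall fun y => ?_)
  · refine (aestronglyMeasurable_const.mul hf).smul (Continuous.aestronglyMeasurable ?_)
    exact (ContinuousMultilinearMap.compContinuousLinearMapLRight
      (E := fun _ : Fin n => Coord → ℂ) (ContinuousMultilinearMap.mkPiAlgebraFin ℂ n ℂ)).cont.comp
        (continuous_pi fun _ => hlam)
  · refine (norm_laplace_term_le y n).trans ?_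
    rw [mul_comm, one_mul]
    gcongr
    exact Real.pow_div_factorial_le_exp _ (norm_nonneg _) n

/-- The exponential is expanded under the integral; `hint` at radius r dominates the series on the
ball of radius r, so the convergence radius is infinite. -/
theorem hasFPowerSeriesOnBall_laplace (hlam : Continuous lam) (hf : AEStronglyMeasurable f)
    (hint : ∀ r : ℝ, Integrable fun y => Real.exp (r * ‖lam y‖) * ‖f y‖) :
    HasFPowerSeriesOnBall (fun x => ∫ y, exp (lam y x) * f y) (laplaceSeries lam f) 0 ∞ where
  r_le := by
    refine ENNReal.le_of_forall_nnreal_lt fun r _ => ?_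
    refine FormalMultilinearSeries.le_radius_of_bound _
      (∫ y, Real.exp (r * ‖lam y‖) * ‖f y‖) fun n => ?_
    rw [laplaceSeries, mul_comm, ← norm_smul_of_nonneg (by positivity), ← integral_smul]
    refine norm_integral_le_of_norm_le (hint r) (Eventually.of_forall fun y => ?_)
    rw [norm_smul_of_nonneg (by positivity)]
    calc _ ≤ (r : ℝ) ^ n * (‖f y‖ * (‖lam y‖ ^ n / n.factorial)) := by
          gcongr; exact norm_laplace_term_le y n
      _ = ((r * ‖lam y‖) ^ n / n.factorial) * ‖f y‖ := by rw [mul_pow]; ring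
      _ ≤ _ := by
          gcongr
          exact Real.pow_div_factorial_le_exp _ (by positivity) n
  r_pos := by simp
  hasSum := by
    intro x _
    have happ : ∀ n, laplaceSeries lam f n (fun _ => x)
        = ∫ y, (n.factorial : ℂ)⁻¹ * f y * (lam y x) ^ n := fun n => by
      have := (ContinuousMultilinearMap.apply ℂ (fun _ : Fin n => Coord → ℂ) ℂ
        (fun _ => x)).integral_comp_comm (integrable_laplace_term hlam hf hint n)
      rw [laplaceSeries]
      refine this.symm.trans ?_
      simp
    simp only [happ, zero_add]
    refine hasSum_integral_of_dominated_convergence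
      (fun n y => (‖x‖ * ‖lam y‖) ^ n / n.factorial * ‖f y‖) (fun n => ?_) (fun n => ?_) ?_ ?_ ?_
    · refine (aestronglyMeasurable_const.mul hf).mul (Continuous.aestronglyMeasurable ?_)
      fun_prop
    · refine Eventually.of_forall fun y => ?_
      rw [norm_mul, norm_mul, norm_inv, norm_natCast, norm_pow]
      have := (lam y).le_opNorm x
      calc _ ≤ (n.factorial : ℝ)⁻¹ * ‖f y‖ * (‖lam y‖ * ‖x‖) ^ n := by gcongr
        _ = _ := by rw [mul_comm ‖x‖]; ring
    · exact Eventually.of_forall fun y => (Real.summable_pow_div_factorial _).mul_right _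
    · refine (hint ‖x‖).congr (Eventually.of_forall fun y => ?_)
      simp only
      rw [tsum_mul_right, Real.exp_eq_exp_ℝ, NormedSpace.exp_eq_tsum_div]
    · refine Eventually.of_forall fun y => ?_
      have := (NormedSpace.expSeries_div_hasSum_exp (lam y x)).mul_right (f y)
      rw [← exp_eq_exp_ℂ] at this
      convert! this using 2 with n
      ring

theorem analyticOnNhd_laplace (hlam : Continuous lam) (hf : AEStronglyMeasurable f)
    (hint : ∀ r : ℝ, Integrable fun y => Real.exp (r * ‖lam y‖) * ‖f y‖) :
    AnalyticOnNhd ℂ (fun x => ∫ y, exp (lam y x) * f y) univ := by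
  have := (hasFPowerSeriesOnBall_laplace hlam hf hint).analyticOnNhd
  rwa [eball_top] at this

end Laplace

section

/-! ### Gaussian smoothing of quasi-periodic sections -/

variable {b : ℂ} {k : ℤ}

/-- A function with unit period in each coordinate takes all its values on the unit cube. -/
theorem exists_mem_cube {Y : Type} {g : (Coord → ℝ) → Y}
    (hg : ∀ j, Function.Periodic g (Pi.single j 1)) (x : Coord → ℝ) :
    ∃ y ∈ Icc (0 : Coord → ℝ) 1, g y = g x := by
  have h : ∀ T : Finset Coord, g (x - ∑ j ∈ T, ⌊x j⌋ • Pi.single j (1 : ℝ)) = g x := by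
    intro T
    induction T using Finset.induction_on with
    | empty => simp
    | insert j T hj ih =>
      rw [Finset.sum_insert hj, add_comm, ← sub_sub, ← ih]
      exact ((hg j).zsmul ⌊x j⌋).sub_eq _
  refine ⟨_, ?_, h Finset.univ⟩
  have : x - ∑ j, ⌊x j⌋ • Pi.single j (1 : ℝ) = fun j => Int.fract (x j) := by
    ext i
    simp [Finset.sum_apply, Pi.single_apply]
  rw [this]
  exact ⟨fun j => Int.fract_nonneg _, fun j => (Int.fract_lt_one _).le⟩

/-- The multipliers of quasi-periodic sections. -/
def quasiFactor (k : ℤ) (j : Coord) (x : Coord → ℝ) : ℂ :=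
  if j.2 = 0 then exp (Real.pi * I * k * x (j.1, 1)) else exp (-(Real.pi * I * k * x (j.1, 0)))

theorem norm_quasiFactor (j : Coord) (x : Coord → ℝ) : ‖quasiFactor k j x‖ = 1 := by
  unfold quasiFactor
  split_ifs <;> simp [norm_exp]

theorem quasiFactor_spec {s : (Coord → ℝ) → ℂ} (hs : s ∈ quasiPeriodic k) (j : Coord)
    (x : Coord → ℝ) : s (x + Pi.single j 1) = quasiFactor k j x * s x := by
  obtain ⟨i, l⟩ := j
  have := hs.2 i x
  fin_cases l
  · simpa [quasiFactor] using this.1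
  · simpa [quasiFactor] using this.2

theorem periodic_norm_sub {s₁ s₂ : (Coord → ℝ) → ℂ}
    (h₁ : ∀ j x, s₁ (x + Pi.single j 1) = quasiFactor k j x * s₁ x)
    (h₂ : ∀ j x, s₂ (x + Pi.single j 1) = quasiFactor k j x * s₂ x) (j : Coord) :
    Function.Periodic (fun x => ‖s₁ x - s₂ x‖) (Pi.single j 1) := by
  intro x
  simp only [h₁, h₂]
  rw [← mul_sub, norm_mul, norm_quasiFactor, one_mul]

theorem exists_norm_le_of_quasiPeriodic {s : (Coord → ℝ) → ℂ} (hs : s ∈ quasiPeriodic k) :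
    ∃ M, 0 ≤ M ∧ ∀ x, ‖s x‖ ≤ M := by
  obtain ⟨M, hM⟩ := (isCompact_Icc (a := (0 : Coord → ℝ)) (b := 1)).exists_bound_of_continuousOn
    hs.1.continuous.continuousOn
  have hle : ∀ x, ‖s x‖ ≤ M := fun x => by
    obtain ⟨y, hy, hyx⟩ := exists_mem_cube (g := fun x => ‖s x - 0‖) (periodic_norm_sub (k := k)
      (s₂ := fun _ => 0) (quasiFactor_spec hs) (by simp)) x
    simp only [sub_zero] at hyx
    rw [← hyx]
    exact hM y hy
  exact ⟨M, (norm_nonneg _).trans (hle 0), hle⟩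

/-- Gaussian smoothing of a section. -/
def smoothed (b : ℂ) (k : ℤ) (A : ℝ) (s : (Coord → ℝ) → ℂ) : Fn := fun x =>
  ∫ y, exp (-A * qC b k (x - toC y) + Real.pi * I * k * omega x (toC y)) * s y

theorem qC_toC (y : Coord → ℝ) : qC b k (toC y) = qR b k y := by
  simp [qC, qR, toC, planeForm]

theorem qR_neg (y : Coord → ℝ) : qR b k (-y) = qR b k y := by
  simp [qR, planeForm]

theorem continuous_qR : Continuous (qR b k) := by
  unfold qR planeForm
  fun_prop

/-- The linear part of the exponent of the Gaussian kernel. -/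
def kernelLinear (b : ℂ) (k : ℤ) (A : ℝ) :
    (Coord → ℝ) →L[ℝ] ((Coord → ℂ) →L[ℂ] ℂ) :=
  let pr : Coord → ((Coord → ℂ) →L[ℂ] ℂ) := fun j => ContinuousLinearMap.proj j
  let pR : Coord → ((Coord → ℝ) →L[ℝ] ℝ) := fun j => ContinuousLinearMap.proj j
  (pR (0, 0)).smulRight
      (((2 * A * Real.pi * (5 / 6) / betaR b : ℝ) : ℂ) • pr (0, 0)
        + ((-(2 * A * Real.pi * kappaR b k / betaR b) : ℝ) + Real.pi * I * k) • pr (0, 1))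
    + (pR (0, 1)).smulRight
      (((2 * A * Real.pi * (3 / 2) / betaR b : ℝ) : ℂ) • pr (0, 1)
        + ((-(2 * A * Real.pi * kappaR b k / betaR b) : ℝ) - Real.pi * I * k) • pr (0, 0))
    + (pR (1, 0)).smulRight
      (((2 * A * Real.pi * (1 / (24 * betaR b)) : ℝ) : ℂ) • pr (1, 0)
        + (Real.pi * I * k : ℂ) • pr (1, 1))
    + (pR (1, 1)).smulRight
      (((2 * A * Real.pi * weightV b k : ℝ) : ℂ) • pr (1, 1)
        - (Real.pi * I * k : ℂ) • pr (1, 0))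

theorem kernel_exponent_eq (A : ℝ) (x : Coord → ℂ) (y : Coord → ℝ) :
    -A * qC b k (x - toC y) + Real.pi * I * k * omega x (toC y)
      = -A * qC b k x + kernelLinear b k A y x - A * qR b k y := by
  simp [qC, qR, omega, kernelLinear, planeForm, toC]
  ring

theorem sq_norm_le_sum (y : Coord → ℝ) : ‖y‖ ^ 2 ≤ ∑ j, y j ^ 2 := by
  obtain ⟨j, hj⟩ : ∃ j, ‖y‖ = ‖y j‖ := by
    obtain ⟨j, -, hj⟩ := Finset.exists_mem_eq_sup' (s := Finset.univ)
      (Finset.univ_nonempty (α := Coord)) fun j => ‖y j‖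
    refine ⟨j, le_antisymm ?_ (norm_le_pi_norm y j)⟩
    rw [← hj]
    exact (pi_norm_le_iff_of_nonempty y).2 fun i => Finset.le_sup' (fun j => ‖y j‖)
      (Finset.mem_univ i)
  rw [hj, Real.norm_eq_abs, sq_abs]
  exact Finset.single_le_sum (f := fun j => y j ^ 2) (fun _ _ => sq_nonneg _) (Finset.mem_univ j)

/-- Splitting the quadratic exponent shows `smoothed` as a Gaussian in x times the Laplace transform
of a function with Gaussian decay. -/
theorem analyticOnNhd_smoothed (hb : 0 < (b ^ 2).im) (hk : 2 * (b ^ 2).re = (k : ℝ)) {A : ℝ}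
    (hA : 0 < A) {s : (Coord → ℝ) → ℂ} (hs : s ∈ quasiPeriodic k) :
    AnalyticOnNhd ℂ (smoothed b k A s) univ := by
  obtain ⟨c, hc, hq⟩ := exists_qR_lower hb hk
  obtain ⟨M, hM0, hM⟩ := exists_norm_le_of_quasiPeriodic hs
  have hsc := hs.1.continuous
  have hqc := continuous_qR (b := b) (k := k)
  have h1 : smoothed b k A s = fun x => exp (-A * qC b k x) *
      ∫ y, exp (kernelLinear b k A y x) * (exp (-A * qR b k y) * s y) := by
    ext x
    rw [smoothed, ← integral_const_mul]
    refine integral_congr_ae (Eventually.of_forall fun y => ?_)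
    simp only
    rw [kernel_exponent_eq, sub_eq_add_neg, exp_add, exp_add, neg_mul (A : ℂ) (qR b k y : ℂ)]
    ring
  rw [h1]
  refine AnalyticOnNhd.mul ?_ (analyticOnNhd_laplace (kernelLinear b k A).continuous ?_ ?_)
  · have : ContDiff ℂ ω fun x : Coord → ℂ => exp (-A * qC b k x) := by
      unfold qC
      fun_prop
    exact this.analyticOnNhd
  · exact Continuous.aestronglyMeasurable (by fun_prop)
  · intro r
    set K := ‖kernelLinear b k A‖ with hK
    have hg := (integrable_gaussian (c := A * c / 2) (by positivity)).const_mul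
      (M * Real.exp ((|r| * K) ^ 2 / (2 * (A * c))))
    refine hg.mono' (Continuous.aestronglyMeasurable ?_) (Eventually.of_forall fun y => ?_)
    · have := (kernelLinear b k A).continuous
      fun_prop
    · rw [Real.norm_of_nonneg (by positivity), norm_mul, norm_exp]
      have e1 : (-(A : ℂ) * qR b k y).re = -A * qR b k y := by
        rw [← ofReal_neg, ← ofReal_mul, ofReal_re]
      have e2 : r * ‖kernelLinear b k A y‖ - A * qR b k y
          ≤ (|r| * K) ^ 2 / (2 * (A * c)) + -(A * c / 2) * ∑ j, y j ^ 2 := by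
        have i1 : r * ‖kernelLinear b k A y‖ ≤ |r| * (K * ‖y‖) := by
          refine mul_le_mul (le_abs_self r) ((kernelLinear b k A).le_opNorm y) (norm_nonneg _)
            (abs_nonneg r)
        have i2 : |r| * (K * ‖y‖) ≤ (|r| * K) ^ 2 / (2 * (A * c)) + A * c / 2 * ‖y‖ ^ 2 := by
          have hAc : 0 < A * c := by positivity
          have : (|r| * K) ^ 2 / (2 * (A * c)) + A * c / 2 * ‖y‖ ^ 2 - |r| * (K * ‖y‖)
              = (|r| * K - A * c * ‖y‖) ^ 2 / (2 * (A * c)) := by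
            field_simp
            ring
          have h0 : 0 ≤ (|r| * K - A * c * ‖y‖) ^ 2 / (2 * (A * c)) := by positivity
          linarith
        have i3 : A * c / 2 * ‖y‖ ^ 2 ≤ A * c / 2 * ∑ j, y j ^ 2 := by
          gcongr
          exact sq_norm_le_sum y
        have i4 := mul_le_mul_of_nonneg_left (hq y) hA.le
        linarith
      rw [e1]
      calc _ = Real.exp (r * ‖kernelLinear b k A y‖ - A * qR b k y) * ‖s y‖ := by
            rw [sub_eq_add_neg, Real.exp_add]; ring_nf
        _ ≤ Real.exp ((|r| * K) ^ 2 / (2 * (A * c)) + -(A * c / 2) * ∑ j, y j ^ 2) * M := by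
            gcongr
            exact hM y
        _ = _ := by rw [Real.exp_add]; ring

theorem qC_re (x : Coord → ℂ) : (qC b k x).re = qR b k (rePart x) - qR b k (imPart x) := by
  have : qC b k x = Real.pi * (((3 / 2 : ℝ) * x (0, 1) ^ 2
    - (2 * kappaR b k : ℝ) * (x (0, 1) * x (0, 0)) + (5 / 6 : ℝ) * x (0, 0) ^ 2) / betaR b
    + ((1 / (24 * betaR b) : ℝ) * x (1, 0) ^ 2 + weightV b k * x (1, 1) ^ 2)) := by
    rw [qC]; push_cast; ring
  rw [this, qR, qR, re_ofReal_mul, add_re, div_ofReal_re]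
  simp only [add_re, sub_re, mul_re, sq, planeForm, rePart, imPart, ofReal_re, ofReal_im]
  ring

theorem omega_sub_right {R : Type} [CommRing R] (x y z : Coord → R) :
    omega x (y - z) = omega x y - omega x z := by
  simp only [omega, Pi.sub_apply]
  ring

/-- With y = Re x + z, the real part of the exponent is -A q(z) + A q(Im x) - πk ω(Im x, Re x + z).
`exists_exponent_le` bounds it with Gaussian decay left over in z, which is then integrated. -/
theorem exists_norm_smoothed_le (hb : 0 < (b ^ 2).im) (hk : 2 * (b ^ 2).re = (k : ℝ))
    {A : ℝ} (hA : A ∈ Icc (2 / 5 : ℝ) (1 / 2)) {s : (Coord → ℝ) → ℂ} (hs : s ∈ quasiPeriodic k) :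
    ∃ C₀ C, ∀ x, ‖smoothed b k A s x‖ ≤ C₀ *
      Real.exp (-(Real.pi * k * omega (imPart x) (rePart x)) + growthR b k C (imPart x)) := by
  obtain ⟨δ, hδ, C, hC⟩ := exists_exponent_le hb hk
  obtain ⟨M, hM0, hM⟩ := exists_norm_le_of_quasiPeriodic hs
  refine ⟨M * ∫ y : Coord → ℝ, Real.exp (-δ * ∑ j, y j ^ 2), C, fun x => ?_⟩
  set E := Real.exp (-(Real.pi * k * omega (imPart x) (rePart x)) + growthR b k C (imPart x))
    with hE
  have hi : Integrable fun y : Coord → ℝ =>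
      M * E * Real.exp (-δ * ∑ j, (y - rePart x) j ^ 2) :=
    ((integrable_gaussian hδ).comp_sub_right (rePart x)).const_mul _
  refine (norm_integral_le_of_norm_le hi (Eventually.of_forall fun y => ?_)).trans ?_
  · rw [norm_mul, norm_exp]
    have e1 : (-(A : ℂ) * qC b k (x - toC y) + Real.pi * I * k * omega x (toC y)).re
        = -A * qR b k (y - rePart x) + A * qR b k (imPart x)
          - Real.pi * k * omega (imPart x) y := by
      have e2 : rePart (x - toC y) = -(y - rePart x) := by
        ext j; simp [rePart, toC]
      have e3 : imPart (x - toC y) = imPart x := by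
        ext j; simp [imPart, toC]
      rw [add_re, ← ofReal_neg, re_ofReal_mul, qC_re, e2, e3, qR_neg]
      simp [omega, toC, imPart]
      ring
    rw [e1]
    have h1 := hC A hA (imPart x) (y - rePart x)
    rw [omega_sub_right] at h1
    calc _ ≤ Real.exp ((-(Real.pi * k * omega (imPart x) (rePart x)) + growthR b k C (imPart x))
          + -δ * ∑ j, (y - rePart x) j ^ 2) * M := by
          gcongr
          · linarith
          · exact hM y
      _ = _ := by rw [Real.exp_add, ← hE]; ring
  · rw [integral_const_mul, integral_sub_right_eq_self
      (fun y : Coord → ℝ => Real.exp (-δ * ∑ j, y j ^ 2))]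
    exact le_of_eq (by ring)

/-- Moving x and y by the same lattice vector fixes x - y, and the change of the phase ω turns the
factor of s at y into the factor at x. -/
theorem quasiPer_smoothed (A : ℝ) {s : (Coord → ℝ) → ℂ} (hs : s ∈ quasiPeriodic k) :
    QuasiPer k (smoothed b k A s) := by
  have key : ∀ (j : Coord) (x : Coord → ℂ) (c : ℂ), (∀ y : Coord → ℝ,
      Real.pi * I * k * omega (x + Pi.single j 1) (toC (y + Pi.single j 1))
        = Real.pi * I * k * omega x (toC y) + c - (if j.2 = 0 then Real.pi * I * k * y (j.1, 1)
          else -(Real.pi * I * k * y (j.1, 0)))) →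
      smoothed b k A s (x + Pi.single j 1) = exp c * smoothed b k A s x := by
    intro j x c hc
    rw [smoothed, smoothed, ← integral_const_mul, ← integral_add_right_eq_self _ (Pi.single j 1)]
    refine integral_congr_ae (Eventually.of_forall fun y => ?_)
    simp only
    have h1 : x + Pi.single j 1 - toC (y + Pi.single j 1) = x - toC y := by
      rw [toC_add_single]; abel
    rw [h1, hc, quasiFactor_spec hs, quasiFactor, ← mul_assoc, ← mul_assoc]
    congr 1
    split_ifs <;> rw [← exp_add, ← exp_add] <;> congr 1 <;> ring
  intro i x
  fin_cases i
  all_goals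
    constructor
    all_goals
      refine key _ _ _ fun y => ?_
      simp [omega, toC]
      ring

/-- The magnetic translate of a section. -/
def magTrans (k : ℤ) (s : (Coord → ℝ) → ℂ) (y x : Coord → ℝ) : ℂ :=
  exp (Real.pi * I * k * omega (toC x) (toC y)) * s (x + y)

/-- At real points smoothing is a Gaussian average over magnetic translates, a curve passing through
s at y = 0. This is the form required by `mem_of_gaussian_integral_mem`. -/
theorem smoothed_toC (A : ℝ) (s : (Coord → ℝ) → ℂ) (x : Coord → ℝ) :
    smoothed b k A s (toC x) = ∫ y, exp (-A * qR b k y) * magTrans k s y x := by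
  rw [smoothed, ← integral_add_left_eq_self _ x]
  refine integral_congr_ae (Eventually.of_forall fun y => ?_)
  simp only [magTrans]
  have h1 : toC x - toC (x + y) = toC (-y) := by
    ext j; simp [toC]
  have h2 : omega (toC x) (toC (x + y)) = omega (toC x) (toC y) := by
    simp [omega, toC]
    ring
  rw [h1, h2, qC_toC, qR_neg, exp_add, mul_assoc]

end

/-! ### Analytic continuation in the width of a Gaussian -/

section GaussianCurve

variable {B : Type} [NormedAddCommGroup B] [NormedSpace ℂ B]
  {q : (Coord → ℝ) → ℝ} {c M : ℝ} {τ : (Coord → ℝ) → B}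

theorem norm_exp_neg_mul_ofReal (A : ℂ) (t : ℝ) : ‖exp (-A * t)‖ = Real.exp (-A.re * t) := by
  rw [norm_exp]
  simp

theorem integrable_exp_neg_form (hq : Continuous q) (hc : 0 < c)
    (hqc : ∀ y, c * ∑ j, y j ^ 2 ≤ q y) {A : ℝ} (hA : 0 < A) :
    Integrable fun y => Real.exp (-A * q y) := by
  refine (integrable_gaussian (c := A * c) (by positivity)).mono'
    (Continuous.aestronglyMeasurable (by fun_prop)) (Eventually.of_forall fun y => ?_)
  rw [Real.norm_of_nonneg (Real.exp_pos _).le]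
  refine Real.exp_le_exp.2 ?_
  have := mul_le_mul_of_nonneg_left (hqc y) hA.le
  linarith

theorem integrable_gaussian_smul (hq : Continuous q) (hc : 0 < c)
    (hqc : ∀ y, c * ∑ j, y j ^ 2 ≤ q y) (hτ : Continuous τ) (hM : ∀ y, ‖τ y‖ ≤ M) {A : ℂ}
    (hA : 0 < A.re) : Integrable fun y => exp (-A * q y) • τ y := by
  refine ((integrable_exp_neg_form hq hc hqc hA).mul_const M).mono'
    (Continuous.aestronglyMeasurable (by fun_prop)) (Eventually.of_forall fun y => ?_)
  rw [norm_smul, norm_exp_neg_mul_ofReal]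
  gcongr
  exact hM y

theorem differentiableAt_gaussian_integral [CompleteSpace B] (hq : Continuous q) (hc : 0 < c)
    (hqc : ∀ y, c * ∑ j, y j ^ 2 ≤ q y) (hτ : Continuous τ) (hM : ∀ y, ‖τ y‖ ≤ M) {A : ℂ}
    (hA : 0 < A.re) :
    DifferentiableAt ℂ (fun A : ℂ => ∫ y, exp (-A * q y) • τ y) A := by
  have hq0 : ∀ y, 0 ≤ q y := fun y => le_trans (by positivity) (hqc y)
  have hM0 : 0 ≤ M := (norm_nonneg _).trans (hM 0)
  have hs : {z : ℂ | A.re / 2 < z.re} ∈ 𝓝 A :=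
    (isOpen_lt continuous_const continuous_re).mem_nhds (by simp only [mem_ofPred_eq]; linarith)
  refine (hasDerivAt_integral_of_dominated_loc_of_deriv_le (𝕜 := ℂ) hs
    (F' := fun z y => (exp (-z * q y) * (-q y)) • τ y)
    (bound := fun y => 4 / A.re * Real.exp (-(A.re / 4) * q y) * M)
    (Eventually.of_forall fun z => Continuous.aestronglyMeasurable (by fun_prop))
    (integrable_gaussian_smul hq hc hqc hτ hM hA)
    (Continuous.aestronglyMeasurable (by fun_prop)) ?_ ?_ ?_).2.differentiableAt
  · refine Eventually.of_forall fun y z hz => ?_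
    rw [norm_smul, norm_mul, norm_exp_neg_mul_ofReal, norm_neg, norm_real,
      Real.norm_of_nonneg (hq0 y)]
    -- Half of the decay rate `A.re / 2` absorbs the factor `q y` produced by differentiation.
    have h1 : q y ≤ 4 / A.re * Real.exp (A.re / 4 * q y) := by
      have := Real.add_one_le_exp (A.re / 4 * q y)
      calc q y = 4 / A.re * (A.re / 4 * q y) := by field_simp
        _ ≤ _ := by gcongr; linarith
    have h2 : Real.exp (-z.re * q y) ≤ Real.exp (-(A.re / 2) * q y) :=
      Real.exp_le_exp.2 (mul_le_mul_of_nonneg_right (neg_le_neg (le_of_lt hz)) (hq0 y))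
    calc _ ≤ Real.exp (-(A.re / 2) * q y) * (4 / A.re * Real.exp (A.re / 4 * q y)) * M := by
          gcongr
          · exact hq0 y
          · exact hM y
      _ = _ := by
          have : Real.exp (-(A.re / 4) * q y)
              = Real.exp (-(A.re / 2) * q y) * Real.exp (A.re / 4 * q y) := by
            rw [← Real.exp_add]; congr 1; ring
          rw [this]; ring
  · exact ((integrable_exp_neg_form hq hc hqc (by positivity)).const_mul _).mul_const _
  · refine Eventually.of_forall fun y z _ => ?_
    have h1 : HasDerivAt (fun z : ℂ => -z * q y) (-q y) z := by
      simpa using (hasDerivAt_id z).neg.mul_const (q y : ℂ)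
    exact h1.cexp.smul_const (τ y)

/-- If the Gaussian averages of `τ` over an interval of widths lie in a closed subspace, then so
does `τ 0`. -/
theorem mem_of_gaussian_integral_mem [CompleteSpace B] (hq : Continuous q) (hc : 0 < c)
    (hqc : ∀ y, c * ∑ j, y j ^ 2 ≤ q y) (hq2 : ∀ (t : ℝ) y, q (t • y) = t ^ 2 * q y)
    (hτ : Continuous τ) (hM : ∀ y, ‖τ y‖ ≤ M) {E : Submodule ℂ B} (hE : IsClosed (E : Set B))
    {a₀ a₁ : ℝ} (ha : 0 < a₀) (ha' : a₀ < a₁)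
    (h : ∀ A ∈ Icc a₀ a₁, ∫ y, exp (-(A : ℂ) * q y) • τ y ∈ E) : τ 0 ∈ E := by
  have : IsClosed (E : Set B) := hE
  set G : ℂ → B := fun A => ∫ y, exp (-A * q y) • τ y with hG
  have hmem : ∀ A : ℝ, 0 < A → G A ∈ E := by
    intro A hA
    have hopen : IsOpen {z : ℂ | 0 < z.re} := isOpen_lt continuous_const continuous_re
    -- In the quotient by `E`, membership becomes vanishing of a holomorphic function, to which the
    -- identity theorem applies.
    have han : AnalyticOnNhd ℂ (fun z => E.mkQL (G z)) {z : ℂ | 0 < z.re} := by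
      refine DifferentiableOn.analyticOnNhd (fun z hz => ?_) hopen
      exact (E.mkQL.differentiableAt.comp z
        (differentiableAt_gaussian_integral hq hc hqc hτ hM hz)).differentiableWithinAt
    have hconn : IsPreconnected {z : ℂ | 0 < z.re} :=
      (convex_halfSpace_re_gt 0).isPreconnected
    have hfr : ∃ᶠ z in 𝓝[≠] (a₀ : ℂ), E.mkQL (G z) = 0 := by
      have ht : Tendsto (fun w : ℝ => (w : ℂ)) (𝓝[>] a₀) (𝓝[≠] (a₀ : ℂ)) := by
        refine tendsto_nhdsWithin_iff.2 ⟨?_, ?_⟩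
        · exact (continuous_ofReal.tendsto a₀).mono_left nhdsWithin_le_nhds
        · filter_upwards [self_mem_nhdsWithin] with w hw
          simpa using (ne_of_gt hw)
      refine ht.frequently (Eventually.frequently ?_)
      filter_upwards [Ioo_mem_nhdsGT ha'] with w hw
      have := h w ⟨hw.1.le, hw.2.le⟩
      simpa [hG] using this
    have := han.eqOn_zero_of_preconnected_of_frequently_eq_zero hconn
      (show (a₀ : ℂ) ∈ {z : ℂ | 0 < z.re} by simpa using ha) hfr
      (show (A : ℂ) ∈ {z : ℂ | 0 < z.re} by simpa using hA)
    simpa using this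
  -- By homogeneity of `q` this is a scalar multiple of `G` at A = (n + 1)². As n grows it tends to
  -- a positive multiple of `τ 0`.
  have hscale : ∀ n : ℕ, ∫ y, exp (-(1 : ℂ) * q y) • τ (((n : ℝ) + 1)⁻¹ • y) ∈ E := by
    intro n
    have hn : (0 : ℝ) < (n : ℝ) + 1 := by positivity
    have h1 := Measure.integral_comp_inv_smul (μ := (volume : Measure (Coord → ℝ)))
      (fun z => exp (-((((n : ℝ) + 1) ^ 2 : ℝ) : ℂ) * q z) • τ z) ((n : ℝ) + 1)
    have h2 : ∀ y, exp (-((((n : ℝ) + 1) ^ 2 : ℝ) : ℂ) * q (((n : ℝ) + 1)⁻¹ • y))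
        = exp (-(1 : ℂ) * q y) := fun y => by
      rw [hq2, neg_mul, ← ofReal_mul, ← mul_assoc, ← mul_pow, mul_inv_cancel₀ hn.ne']
      simp
    simp only [h2] at h1
    rw [h1, RCLike.real_smul_eq_coe_smul (K := ℂ)]
    exact E.smul_mem _ (hmem _ (by positivity))
  have hM0 : 0 ≤ M := (norm_nonneg _).trans (hM 0)
  have hint := integrable_exp_neg_form hq hc hqc one_pos
  have hlim : Tendsto (fun n : ℕ => ∫ y, exp (-(1 : ℂ) * q y) • τ (((n : ℝ) + 1)⁻¹ • y)) atTop
      (𝓝 (∫ y, exp (-(1 : ℂ) * q y) • τ 0)) := by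
    refine tendsto_integral_of_dominated_convergence (fun y => Real.exp (-1 * q y) * M)
      (fun n => Continuous.aestronglyMeasurable (by fun_prop)) (hint.mul_const M)
      (fun n => Eventually.of_forall fun y => ?_) (Eventually.of_forall fun y => ?_)
    · rw [norm_smul, norm_exp_neg_mul_ofReal, one_re]
      gcongr
      exact hM _
    · have h0 : Tendsto (fun n : ℕ => ((n : ℝ) + 1)⁻¹ • y) atTop (𝓝 0) := by
        have := (tendsto_one_div_add_atTop_nhds_zero_nat (𝕜 := ℝ)).smul_const y
        simpa using this
      exact ((hτ.tendsto 0).comp h0).const_smul _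
  have hmem0 := hE.mem_of_tendsto hlim (Eventually.of_forall hscale)
  rw [integral_smul_const] at hmem0
  have hpos : 0 < ∫ y, Real.exp (-1 * q y) := integral_exp_pos hint
  have hval : ∫ y, exp (-(1 : ℂ) * q y) = ((∫ y, Real.exp (-1 * q y) : ℝ) : ℂ) := by
    rw [← integral_complex_ofReal]
    refine integral_congr_ae (Eventually.of_forall fun y => ?_)
    simp
  rw [hval] at hmem0
  exact (E.smul_mem_iff (ofReal_ne_zero.2 hpos.ne')).1 hmem0

end GaussianCurve

section

/-! ### Density of the domain -/

variable {b : ℂ} {k : ℤ}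

/-- The unit cube. -/
abbrev Cube : Set (Coord → ℝ) := Icc 0 1

theorem Admissible.add {S T : Fn} (hS : Admissible b k S) (hT : Admissible b k T) :
    Admissible b k fun x => S x + T x := by
  intro L hL r
  obtain ⟨C, hC⟩ := hS L hL r
  obtain ⟨D, hD⟩ := hT L hL r
  refine ⟨C + D, fun m n x hx => ?_⟩
  have h : ((shiftX b k)^[m] ((shiftXt b k)^[n] fun x => S x + T x)) x
      = ((shiftX b k)^[m] ((shiftXt b k)^[n] S)) x
        + ((shiftX b k)^[m] ((shiftXt b k)^[n] T)) x := by
    simp only [iterate_shiftX_apply, iterate_shiftXt_apply]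
    ring
  rw [h, add_mul]
  refine le_trans ?_ (add_le_add (hC m n x hx) (hD m n x hx))
  rw [← mul_add]
  gcongr
  exact norm_add_le _ _

theorem Admissible.const_mul {S : Fn} (hS : Admissible b k S) (a : ℂ) :
    Admissible b k fun x => a * S x := by
  intro L hL r
  obtain ⟨C, hC⟩ := hS L hL r
  refine ⟨‖a‖ * C, fun m n x hx => ?_⟩
  have h : ((shiftX b k)^[m] ((shiftXt b k)^[n] fun x => a * S x)) x
      = a * ((shiftX b k)^[m] ((shiftXt b k)^[n] S)) x := by
    simp only [iterate_shiftX_apply, iterate_shiftXt_apply]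
    ring
  rw [h, norm_mul, mul_left_comm, mul_assoc]
  exact mul_le_mul_of_nonneg_left (hC m n x hx) (norm_nonneg a)

theorem QuasiPer.add {S T : Fn} (hS : QuasiPer k S) (hT : QuasiPer k T) :
    QuasiPer k fun x => S x + T x := by
  intro i x
  simp only [(hS i x).1, (hS i x).2, (hT i x).1, (hT i x).2]
  constructor <;> ring

/-- Restrictions to the unit cube of admissible quasi-periodic entire functions. -/
def admissibleOnCube (b : ℂ) (k : ℤ) : Submodule ℂ C(Cube, ℂ) where
  carrier := {f | ∃ S : Fn, AnalyticOnNhd ℂ S univ ∧ QuasiPer k S ∧ Admissible b k S ∧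
    ∀ x : Cube, f x = S (toC x)}
  add_mem' := by
    rintro f g ⟨S, hS, qS, aS, hf⟩ ⟨T, hT, qT, aT, hg⟩
    exact ⟨fun x => S x + T x, hS.add hT, qS.add qT, aS.add aT, fun x => by simp [hf, hg]⟩
  zero_mem' := by
    refine ⟨fun _ => 0, analyticOnNhd_const, fun i x => by simp, fun L hL r => ?_, by simp⟩
    refine ⟨0, fun m n x _ => ?_⟩
    simp [iterate_shiftX_apply, iterate_shiftXt_apply]
  smul_mem' := by
    rintro a f ⟨S, hS, qS, aS, hf⟩
    exact ⟨fun x => a * S x, analyticOnNhd_const.mul hS, qS.const_mul a, aS.const_mul a,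
      fun x => by simp [hf]⟩

theorem continuous_magTrans {s : (Coord → ℝ) → ℂ} (hs : Continuous s) :
    Continuous fun p : (Coord → ℝ) × (Coord → ℝ) => magTrans k s p.1 p.2 := by
  unfold magTrans omega toC
  fun_prop

/-- The magnetic translates of a section as a curve of functions on the cube. -/
def magCurve (k : ℤ) {s : (Coord → ℝ) → ℂ} (hs : Continuous s) :
    C(Coord → ℝ, C(Cube, ℂ)) :=
  ContinuousMap.curry ⟨fun p : (Coord → ℝ) × Cube => magTrans k s p.1 p.2,
    Continuous.comp (g := fun p : (Coord → ℝ) × (Coord → ℝ) => magTrans k s p.1 p.2)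
      (f := fun p : (Coord → ℝ) × Cube => (p.1, (p.2 : Coord → ℝ)))
      (continuous_magTrans hs) (by fun_prop)⟩

theorem norm_magTrans (s : (Coord → ℝ) → ℂ) (y x : Coord → ℝ) :
    ‖magTrans k s y x‖ = ‖s (x + y)‖ := by
  rw [magTrans, norm_mul, norm_exp]
  have : (Real.pi * I * k * omega (toC x) (toC y)).re = 0 := by
    simp [omega, toC]
  rw [this, Real.exp_zero, one_mul]

theorem qR_smul (t : ℝ) (y : Coord → ℝ) : qR b k (t • y) = t ^ 2 * qR b k y := by
  simp [qR, planeForm]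
  ring

theorem magCurve_zero_mem_closure (hb : 0 < (b ^ 2).im) (hk : 2 * (b ^ 2).re = (k : ℝ))
    {s : (Coord → ℝ) → ℂ} (hs : s ∈ quasiPeriodic k) :
    magCurve k hs.1.continuous 0 ∈ (admissibleOnCube b k).topologicalClosure := by
  obtain ⟨c, hc, hq⟩ := exists_qR_lower hb hk
  obtain ⟨M, hM0, hM⟩ := exists_norm_le_of_quasiPeriodic hs
  have hMτ : ∀ y, ‖magCurve k hs.1.continuous y‖ ≤ M := fun y => by
    refine (ContinuousMap.norm_le _ hM0).2 fun x => ?_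
    change ‖magTrans k s y x‖ ≤ M
    rw [norm_magTrans]
    exact hM _
  refine mem_of_gaussian_integral_mem (a₀ := 2 / 5) (a₁ := 1 / 2) continuous_qR hc hq qR_smul
    (magCurve k hs.1.continuous).continuous hMτ
    (admissibleOnCube b k).isClosed_topologicalClosure (by norm_num) (by norm_num)
    fun A hA => Submodule.le_topologicalClosure _ ?_
  have hA0 : 0 < A := by linarith [hA.1]
  obtain ⟨C₀, C, hg⟩ := exists_norm_smoothed_le hb hk hA hs
  refine ⟨smoothed b k A s, analyticOnNhd_smoothed hb hk hA0 hs, quasiPer_smoothed A hs,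
    admissible_of_growth hb hg, fun x => ?_⟩
  rw [ContinuousMap.integral_apply (integrable_gaussian_smul continuous_qR hc hq
    (magCurve k hs.1.continuous).continuous hMτ (by simpa using hA0)), smoothed_toC]
  rfl

/-- Both sections have the same unimodular factors, so the norm of their difference is lattice
periodic and approximation on the cube is global. -/
theorem exists_admissible_near (hb : 0 < (b ^ 2).im) (hk : 2 * (b ^ 2).re = (k : ℝ))
    {s : (Coord → ℝ) → ℂ} (hs : s ∈ quasiPeriodic k) {ε : ℝ} (hε : 0 < ε) :
    ∃ S : Fn, AnalyticOnNhd ℂ S univ ∧ QuasiPer k S ∧ Admissible b k S ∧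
      ∀ x, ‖s x - S (toC x)‖ < ε := by
  obtain ⟨f, ⟨S, hS, qS, aS, hf⟩, hd⟩ :=
    Metric.mem_closure_iff.1 (magCurve_zero_mem_closure hb hk hs) ε hε
  refine ⟨S, hS, qS, aS, fun x => ?_⟩
  have hS' := mem_quasiPeriodic (AnalyticOnNhd.contDiff hS) qS
  obtain ⟨y, hy, hyx⟩ := exists_mem_cube (periodic_norm_sub (quasiFactor_spec hs)
    (quasiFactor_spec hS')) x
  rw [← hyx]
  have h1 := (ContinuousMap.dist_apply_le_dist (⟨y, hy⟩ : Cube)).trans_lt hd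
  rw [dist_eq_norm, hf] at h1
  have h2 : magCurve k hs.1.continuous 0 ⟨y, hy⟩ = s y := by
    change magTrans k s 0 y = s y
    simp [magTrans, omega, toC]
  rwa [h2] at h1

theorem toC_nil (x : Coord → ℝ) : toC (nil x) = nilG (toC x) := by
  rw [nilG_apply]
  ext ⟨i, j⟩
  fin_cases i <;> fin_cases j <;> simp [toC, nil]

theorem comp_add_nil_mem_quasiPeriodic {s : (Coord → ℝ) → ℂ} (hs : s ∈ quasiPeriodic k) :
    (fun x => s (x + nil x)) ∈ quasiPeriodic k := by
  refine ⟨hs.1.comp (contDiff_id.add (contDiff_pi.2 fun j => ?_)), ?_⟩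
  · obtain ⟨i, l⟩ := j
    fin_cases i <;> fin_cases l <;> simp [nil] <;> fun_prop
  · exact QuasiPerVia.comp_add_nil (φ := ofRealHom) hs.2

/-- The sheared section is approximated by an admissible S, and `opG` sends the inversely sheared S
back to S. The shear permutes the real points, so the uniform distance is unchanged. -/
theorem exists_TGraph_near (hb : 0 < (b ^ 2).im) (hk : 2 * (b ^ 2).re = (k : ℝ))
    (hk' : b ^ 2 + conj b ^ 2 = k) {s : (Coord → ℝ) → ℂ} (hs : s ∈ quasiPeriodic k) {ε : ℝ}
    (hε : 0 < ε) : ∃ s₀ ∈ quasiPeriodic k, (∃ r, TGraph b k s₀ r) ∧ ∀ x, ‖s x - s₀ x‖ < ε := by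
  have hb0 : b ≠ 0 := fun h => by simp [h] at hb
  obtain ⟨S, hS, qS, aS, hSs⟩ := exists_admissible_near hb hk
    (comp_add_nil_mem_quasiPeriodic hs) hε
  have eS : Entire S := hS.contDiff
  have hT : AnalyticOnNhd ℂ (fun x => S (x - nilG x)) univ :=
    hS.comp (g := S) (f := fun x => x - nilG x)
      (analyticOnNhd_id.sub (nilG.analyticOnNhd univ)) fun _ _ => mem_univ _
  have eT : Entire fun x => S (x - nilG x) := hT.contDiff
  have hG : opG b k (fun x => S (x - nilG x)) = S := by
    rw [opG_eq k hb0 hk' eT]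
    ext x
    have : nilG (nilG x) = 0 := by rw [nilG_apply, nilG_apply]; simp
    rw [map_add, this, add_zero, add_sub_cancel_right]
  obtain ⟨Q, R, hQ, hR⟩ := aS.exists_apply hb eS
  refine ⟨_, mem_quasiPeriodic eT qS.comp_sub_nilG,
    ⟨fun x => R (toC x), _, Q, R, hT, fun x => rfl, hG.symm ▸ hQ, hR, fun x => rfl⟩, fun x => ?_⟩
  have h1 := hSs (x - nil x)
  have h2 : x - nil x + nil (x - nil x) = x := by
    have : nil (x - nil x) = nil x := by
      have := nil_add (x - nil x) (nil x)
      rw [sub_add_cancel, nil_nil, add_zero] at this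
      exact this.symm
    rw [this, sub_add_cancel]
  have h3 : toC (x - nil x) = toC x - nilG (toC x) := by
    rw [← toC_nil]
    ext j
    simp [toC]
  rwa [h2, h3] at h1

end

end ComplexCS

end

theorem mainTheorem9 (b : ℂ) (k : ℤ) (hk : 2 * (b ^ 2).re = (k : ℝ)) (hb : 0 < (b ^ 2).im) :
    (∀ s r r' : (ComplexCS.Coord → ℝ) → ℂ,
      ComplexCS.TGraph b k s r → ComplexCS.TGraph b k s r' → r = r') ∧
    (∀ s ∈ ComplexCS.quasiPeriodic k, ∀ ε : ℝ, 0 < ε →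
      ∃ s₀ ∈ ComplexCS.quasiPeriodic k,
        (∃ r, ComplexCS.TGraph b k s₀ r) ∧ ∀ x, ‖s x - s₀ x‖ < ε) ∧
    (∀ s ∈ ComplexCS.quasiPeriodic k, ∀ r, ComplexCS.TGraph b k s r →
      r ∈ ComplexCS.quasiPeriodic k) := by
  have hb0 : b ≠ 0 := fun h => by simp [h] at hb
  have hk' : b ^ 2 + (starRingEnd ℂ) b ^ 2 = k := by
    rw [← map_pow, Complex.add_conj, hk]
    simp
  exact ⟨fun s r r' h h' => h.unique h',
    fun s hs ε hε => ComplexCS.exists_TGraph_near hb hk hk' hs hε,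
    fun s hs r h => h.mem_quasiPeriodic hb0 hk' hs⟩
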